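/- **The calculus.** Fix a set of name sorts $k$, each with a set of name constants and a set of name variables; a name is a name constant or a name variable. Types are given by $T ::= \mathrm{proc} \mid T\to\mathrm{proc} \mid k\to\mathrm{proc}$ ($k$ a name sort), and each name sort $k$ carries terms of a fixed type $\mathrm{obj}(k)$. Terms (up to $\alpha$-conversion, possibly with free process variables $X$ and free name variables $x$) are the well-typed expressions $$P,Q ::= 0 \mid X \mid m(X).P \mid \overline m(Q) \mid P\,|\,Q \mid \langle X\rangle P \mid P\langle Q\rangle \mid \langle x\rangle P \mid P\langle n\rangle ,$$ where $0$, $m(X).P$, $\overline m(Q)$, $P|Q$, $P\langle Q\rangle$, $P\langle n\rangle$ have type $\mathrm{proc}$; the bodies of prefixes and abstractions and the components of $|$ have type $\mathrm{proc}$; $X$ in $m(X).P$ and $Q$ in $\overline m(Q)$ have the type carried by $m$; $\langle X\rangle P$ has type $T\to\mathrm{proc}$ for $X$ of type $T$ and is applied to terms of type $T$; $\langle x\rangle P$ has type $k\to\mathrm{proc}$ for $x$ of sort $k$ and is applied to names of sort $k$. Terms of the form $\langle X\rangle P$ or $\langle x\rangle P$ are called abstractions. Structural congruence $\equiv$ is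 the smallest congruence with the commutative monoid laws for $|$ and $0$, $(\langle X\rangle P)\langle Q\rangle\equiv P\{Q/X\}$ and $(\langle x\rangle P)\langle m\rangle\equiv P\{m/x\}$. Transitions are generated by $m(X).P\xrightarrow{m(X)}P$ and $\overline m(Q)\xrightarrow{\overline m(Q)}0$, closed under parallel composition (with the bound variable of the action not free in the other component) and under $\equiv$ on both sides. **Bisimilarity.** $\sim$ is the largest strong HO-IO bisimulation, that is, the largest symmetric relation $\mathcal R$ between terms of equal type such that $P\,\mathcal R\,Q$ implies: (1) if $P$ is not an abstraction, neither is $Q$; (2) if $P=\langle Y\rangle A$ then $Q=\langle Y\rangle B$ with $A\,\mathcal R\,B$; (3) if $P=\langle y\rangle A$ then $Q=\langle y\rangle B$ with $A\,\mathcal R\,B$; (4) if $P\xrightarrow{\overline m(A)}P'$ then $Q\xrightarrow{\overline m(B)}Q'$ with $A\,\mathcal R\,B$ and $P'\,\mathcal R\,Q'$; (5) if $P\xrightarrow{m(X)}P'$ then $Q\xrightarrow{m(X)}Q'$ with $P'\,\mathcal R\,Q'$; (6) if $P\equiv X|P'$ then $Q\equiv X|Q'$ with $P'\,\mathcal R\,Q'$,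 and, for $X$ of abstraction type, if $P=X$ then $Q\equiv X$; (7) if $P\equiv X\langle A\rangle|P'$ then $Q\equiv X\langle B\rangle|Q'$ with $A\,\mathcal R\,B$ and $P'\,\mathcal R\,Q'$; (8) if $P\equiv X\langle n\rangle|P'$ then $Q\equiv X\langle n\rangle|Q'$ with $P'\,\mathcal R\,Q'$. Here $m,n$ range over all names. **Axioms and normal forms.** The axiom system $\mathcal A$ consists of the commutative monoid laws for $|$ and $0$ and the laws $$(DIS)\;\; m(X).\Bigl(P\,|\,\prod_{1}^{k-1}m(X).P\Bigr)=\prod_{1}^{k}m(X).P\ \ (k\ge2),\quad (APP1)\;\;(\langle X\rangle P)\langle Q\rangle=P\{Q/X\},\quad (APP2)\;\;(\langle x\rangle P)\langle m\rangle=P\{m/x\}.$$ Write $\mathcal A\vdash P=Q$ if $P$ and $Q$ are related by the smallest congruence containing these laws. Write $P\rightsquigarrow Q$ if, up to the commutative monoid laws (applied anywhere in $P$ and $Q$), $Q$ arises from $P$ by rewriting one subterm by DIS, APP1 or APP2 from left to right. A term is in normal form if it has no $\rightsquigarrow$-step; a normal form of $P$ is a term $N$ in normal form with $P\rightsquigarrow^*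 N$. **Theorem (Completeness).** Let $P,Q$ be terms of the same type. Then: 1. $P$ has a normal form, unique up to $\equiv$; denote it by $\mathsf{nf}(P)$. 2. (Soundness) If $P\rightsquigarrow Q$ then $P\sim Q$; and $P\sim\mathsf{nf}(P)$. 3. (Completeness) If $P\sim Q$ then $\mathsf{nf}(P)\equiv\mathsf{nf}(Q)$; the converse holds as well. 4. Hence $P\sim Q$ if and only if $\mathcal A\vdash P=Q$. -/

import Mathlib

namespace HOmp

universe u

/-- Types of terms over a set `K` of name sorts. `proc`: non-abstractions (processes);
`pabs S`: process abstractions `⟨X⟩P` with `X` of type `S`; `nabs k`: name abstractions `⟨x⟩P` with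
`x` of sort `k`. The body of an abstraction is a process, as in Sangiorgi's typing of abstractions
(`T → ◇`). As `Ty` is inductive, every abstraction has finite order. -/
inductive Ty (K : Type u) : Type u
  | proc : Ty K
  | pabs : Ty K → Ty K
  | nabs : K → Ty K

/-- A sorting of names: name sorts, the type of the terms carried by channels of each sort
(recursion through name sorts is allowed), and the name constants of each sort. -/
structure Sorting where
  NSort : Type u
  obj : NSort → Ty NSort
  Const : NSort → Type u

/-- De Bruijn variables: positions in a context. -/
inductive Var {K : Type u} : List K → K → Type u
  | z {Γ : List K} {T : K} : Var (T :: Γ) T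
  | s {Γ : List K} {S T : K} : Var Γ T → Var (S :: Γ) T

/-- Names of sort `k`: name constants, and name variables declared in `Δ`. -/
inductive Name (σ : Sorting.{u}) (Δ : List σ.NSort) (k : σ.NSort) : Type u
  | const : σ.Const k → Name σ Δ k
  | var : Var Δ k → Name σ Δ k

/-- Well-formed terms (up to α-conversion) of a given type, with free process variables in `Γ` and
free name variables in `Δ`. -/
inductive Tm (σ : Sorting.{u}) :
    List (Ty σ.NSort) → List σ.NSort → Ty σ.NSort → Type u
  /-- `0` -/
  | nil {Γ : List (Ty σ.NSort)} {Δ : List σ.NSort} : Tm σ Γ Δ .proc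
  /-- `X` -/
  | var {Γ : List (Ty σ.NSort)} {Δ : List σ.NSort} {T : Ty σ.NSort} : Var Γ T → Tm σ Γ Δ T
  /-- `m(X).P` -/
  | inp {Γ : List (Ty σ.NSort)} {Δ : List σ.NSort} {k : σ.NSort} :
      Name σ Δ k → Tm σ (σ.obj k :: Γ) Δ .proc → Tm σ Γ Δ .proc
  /-- the output of `Q` on `m` -/
  | out {Γ : List (Ty σ.NSort)} {Δ : List σ.NSort} {k : σ.NSort} :
      Name σ Δ k → Tm σ Γ Δ (σ.obj k) → Tm σ Γ Δ .proc
  /-- `P | Q` -/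
  | par {Γ : List (Ty σ.NSort)} {Δ : List σ.NSort} :
      Tm σ Γ Δ .proc → Tm σ Γ Δ .proc → Tm σ Γ Δ .proc
  /-- `⟨X⟩P` -/
  | pabs {Γ : List (Ty σ.NSort)} {Δ : List σ.NSort} {S : Ty σ.NSort} :
      Tm σ (S :: Γ) Δ .proc → Tm σ Γ Δ (.pabs S)
  /-- `P⟨Q⟩` -/
  | papp {Γ : List (Ty σ.NSort)} {Δ : List σ.NSort} {S : Ty σ.NSort} :
      Tm σ Γ Δ (.pabs S) → Tm σ Γ Δ S → Tm σ Γ Δ .proc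
  /-- `⟨x⟩P` -/
  | nabs {Γ : List (Ty σ.NSort)} {Δ : List σ.NSort} {k : σ.NSort} :
      Tm σ Γ (k :: Δ) .proc → Tm σ Γ Δ (.nabs k)
  /-- `P⟨n⟩` -/
  | napp {Γ : List (Ty σ.NSort)} {Δ : List σ.NSort} {k : σ.NSort} :
      Tm σ Γ Δ (.nabs k) → Name σ Δ k → Tm σ Γ Δ .proc

section Substitution

variable {σ : Sorting.{u}} {Γ Γ' : List (Ty σ.NSort)} {Δ Δ' : List σ.NSort}

/-- Renamings of process variables. -/
abbrev PRen (σ : Sorting.{u}) (Γ Γ' : List (Ty σ.NSort)) : Type u :=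
  ∀ ⦃T : Ty σ.NSort⦄, Var Γ T → Var Γ' T

/-- Simultaneous substitutions of names for name variables. -/
abbrev NSub (σ : Sorting.{u}) (Δ Δ' : List σ.NSort) : Type u :=
  ∀ ⦃k : σ.NSort⦄, Var Δ k → Name σ Δ' k

/-- Simultaneous substitutions of terms for process variables. -/
abbrev PSub (σ : Sorting.{u}) (Γ Γ' : List (Ty σ.NSort)) (Δ : List σ.NSort) : Type u :=
  ∀ ⦃T : Ty σ.NSort⦄, Var Γ T → Tm σ Γ' Δ T

def PRen.lift (ρ : PRen σ Γ Γ') {S : Ty σ.NSort} : PRen σ (S :: Γ) (S :: Γ')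
  | _, .z => .z
  | _, .s x => .s (ρ x)

def Name.sub (ν : NSub σ Δ Δ') {k : σ.NSort} : Name σ Δ k → Name σ Δ' k
  | .const c => .const c
  | .var x => ν x

/-- Weakening of the name context by one variable. -/
def NSub.wk {k : σ.NSort} : NSub σ Δ (k :: Δ) := fun _ x => .var (.s x)

def NSub.lift (ν : NSub σ Δ Δ') {k : σ.NSort} : NSub σ (k :: Δ) (k :: Δ')
  | _, .z => .var .z
  | _, .s x => (ν x).sub NSub.wk

/-- Renames process variables by `ρ` and substitutes names for name variables by `ν`. -/
def Tm.ren {Γ : List (Ty σ.NSort)} {Δ : List σ.NSort} {T : Ty σ.NSort} (P : Tm σ Γ Δ T)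
    {Γ' : List (Ty σ.NSort)} {Δ' : List σ.NSort} (ρ : PRen σ Γ Γ') (ν : NSub σ Δ Δ') :
    Tm σ Γ' Δ' T :=
  match P with
  | .nil => .nil
  | .var x => .var (ρ x)
  | .inp m P => .inp (m.sub ν) (P.ren (PRen.lift ρ) ν)
  | .out m Q => .out (m.sub ν) (Q.ren ρ ν)
  | .par P Q => .par (P.ren ρ ν) (Q.ren ρ ν)
  | .pabs P => .pabs (P.ren (PRen.lift ρ) ν)
  | .papp P Q => .papp (P.ren ρ ν) (Q.ren ρ ν)
  | .nabs P => .nabs (P.ren ρ (NSub.lift ν))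
  | .napp P n => .napp (P.ren ρ ν) (n.sub ν)

/-- `P` in a context with one more process variable, which does not occur in `P`. -/
def Tm.wkP {T S : Ty σ.NSort} (P : Tm σ Γ Δ T) : Tm σ (S :: Γ) Δ T :=
  P.ren (fun _ x => .s x) (fun _ x => .var x)

/-- `P` in a context with one more name variable, which does not occur in `P`. -/
def Tm.wkN {T : Ty σ.NSort} {k : σ.NSort} (P : Tm σ Γ Δ T) : Tm σ Γ (k :: Δ) T :=
  P.ren (fun _ x => x) NSub.wk

def PSub.liftP (θ : PSub σ Γ Γ' Δ) {S : Ty σ.NSort} : PSub σ (S :: Γ) (S :: Γ') Δ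
  | _, .z => .var .z
  | _, .s x => (θ x).wkP

def PSub.liftN (θ : PSub σ Γ Γ' Δ) {k : σ.NSort} : PSub σ Γ Γ' (k :: Δ) :=
  fun _ x => (θ x).wkN

/-- Capture-avoiding simultaneous substitution of terms for process variables. -/
def Tm.sub {Γ : List (Ty σ.NSort)} {Δ : List σ.NSort} {T : Ty σ.NSort} (P : Tm σ Γ Δ T)
    {Γ' : List (Ty σ.NSort)} (θ : PSub σ Γ Γ' Δ) : Tm σ Γ' Δ T :=
  match P with
  | .nil => .nil
  | .var x => θ x
  | .inp m P => .inp m (P.sub (PSub.liftP θ))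
  | .out m Q => .out m (Q.sub θ)
  | .par P Q => .par (P.sub θ) (Q.sub θ)
  | .pabs P => .pabs (P.sub (PSub.liftP θ))
  | .papp P Q => .papp (P.sub θ) (Q.sub θ)
  | .nabs P => .nabs (P.sub (PSub.liftN θ))
  | .napp P n => .napp (P.sub θ) n

def PSub.single {S : Ty σ.NSort} (Q : Tm σ Γ Δ S) : PSub σ (S :: Γ) Γ Δ
  | _, .z => Q
  | _, .s x => .var x

def NSub.single {k : σ.NSort} (m : Name σ Δ k) : NSub σ (k :: Δ) Δ
  | _, .z => m
  | _, .s x => .var x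

/-- `P{Q/X}`, where `X` is the most recent process variable. -/
def Tm.psubst {S T : Ty σ.NSort} (P : Tm σ (S :: Γ) Δ T) (Q : Tm σ Γ Δ S) : Tm σ Γ Δ T :=
  P.sub (PSub.single Q)

/-- `P{m/x}`, where `x` is the most recent name variable. -/
def Tm.nsubst {T : Ty σ.NSort} {k : σ.NSort} (P : Tm σ Γ (k :: Δ) T) (m : Name σ Δ k) :
    Tm σ Γ Δ T :=
  P.ren (fun _ x => x) (NSub.single m)

/-- The parallel composition of `n` copies of `P` (`0` if `n = 0`). -/
def Tm.copies : ℕ → Tm σ Γ Δ .proc → Tm σ Γ Δ .proc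
  | 0, _ => .nil
  | n + 1, P => .par P (Tm.copies n P)

/-- `P` has the form `⟨X⟩A` or `⟨x⟩A`. -/
def Tm.IsAbs {T : Ty σ.NSort} : Tm σ Γ Δ T → Prop
  | .pabs _ => True
  | .nabs _ => True
  | _ => False

end Substitution

/-- Binary relations on terms. They relate terms of the same type in the same context. -/
abbrev TRel (σ : Sorting.{u}) : Type u :=
  ∀ ⦃Γ : List (Ty σ.NSort)⦄ ⦃Δ : List σ.NSort⦄ ⦃T : Ty σ.NSort⦄, Tm σ Γ Δ T → Tm σ Γ Δ T → Prop

section Laws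

variable {σ : Sorting.{u}}

/-- The commutative monoid laws for parallel composition. -/
inductive MonoidLaw : TRel σ
  | assoc {Γ Δ} (P Q R : Tm σ Γ Δ .proc) : MonoidLaw (.par (.par P Q) R) (.par P (.par Q R))
  | comm {Γ Δ} (P Q : Tm σ Γ Δ .proc) : MonoidLaw (.par P Q) (.par Q P)
  | unit {Γ Δ} (P : Tm σ Γ Δ .proc) : MonoidLaw (.par P .nil) P

/-- The application laws: `(⟨X⟩P)⟨Q⟩ = P{Q/X}` and `(⟨x⟩P)⟨m⟩ = P{m/x}`. -/
inductive AppLaw : TRel σ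
  | app1 {Γ Δ S} (P : Tm σ (S :: Γ) Δ .proc) (Q : Tm σ Γ Δ S) :
      AppLaw (.papp (.pabs P) Q) (P.psubst Q)
  | app2 {Γ Δ k} (P : Tm σ Γ (k :: Δ) .proc) (m : Name σ Δ k) :
      AppLaw (.napp (.nabs P) m) (P.nsubst m)

/-- The distribution law `m(X).(P | ∏_{1}^{k-1} m(X).P) = ∏_{1}^{k} m(X).P`, for `k ≥ 2` (for
`k = 1` both sides agree). The inner copies of `m(X).P` rebind `X`, so they are weakened. -/
inductive DisLaw : TRel σ
  | dis {Γ Δ} {s : σ.NSort} (m : Name σ Δ s) (P : Tm σ (σ.obj s :: Γ) Δ .proc) (k : ℕ)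
      (hk : 2 ≤ k) :
      DisLaw (.inp m (.par P (Tm.copies (k - 1) (Tm.inp m P).wkP))) (Tm.copies k (.inp m P))

/-- The smallest congruence containing `B`. -/
inductive Cong (B : TRel σ) : TRel σ
  | base {Γ Δ T} {P Q : Tm σ Γ Δ T} : B P Q → Cong B P Q
  | refl {Γ Δ T} (P : Tm σ Γ Δ T) : Cong B P P
  | symm {Γ Δ T} {P Q : Tm σ Γ Δ T} : Cong B P Q → Cong B Q P
  | trans {Γ Δ T} {P Q R : Tm σ Γ Δ T} : Cong B P Q → Cong B Q R → Cong B P R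
  | inp {Γ Δ} {k : σ.NSort} (m : Name σ Δ k) {P Q : Tm σ (σ.obj k :: Γ) Δ .proc} :
      Cong B P Q → Cong B (.inp m P) (.inp m Q)
  | out {Γ Δ} {k : σ.NSort} (m : Name σ Δ k) {P Q : Tm σ Γ Δ (σ.obj k)} :
      Cong B P Q → Cong B (.out m P) (.out m Q)
  | par {Γ Δ} {P P' Q Q' : Tm σ Γ Δ .proc} :
      Cong B P P' → Cong B Q Q' → Cong B (.par P Q) (.par P' Q')
  | pabs {Γ Δ S} {P Q : Tm σ (S :: Γ) Δ .proc} : Cong B P Q → Cong B (.pabs P) (.pabs Q)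
  | papp {Γ Δ S} {P P' : Tm σ Γ Δ (.pabs S)} {Q Q' : Tm σ Γ Δ S} :
      Cong B P P' → Cong B Q Q' → Cong B (.papp P Q) (.papp P' Q')
  | nabs {Γ Δ k} {P Q : Tm σ Γ (k :: Δ) .proc} : Cong B P Q → Cong B (.nabs P) (.nabs Q)
  | napp {Γ Δ k} {P P' : Tm σ Γ Δ (.nabs k)} (n : Name σ Δ k) :
      Cong B P P' → Cong B (.napp P n) (.napp P' n)

/-- `InSubterm B P Q`: `Q` is obtained from `P` by rewriting one subterm along `B`. -/
inductive InSubterm (B : TRel σ) : TRel σ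
  | here {Γ Δ T} {P Q : Tm σ Γ Δ T} : B P Q → InSubterm B P Q
  | inp {Γ Δ} {k : σ.NSort} (m : Name σ Δ k) {P Q : Tm σ (σ.obj k :: Γ) Δ .proc} :
      InSubterm B P Q → InSubterm B (.inp m P) (.inp m Q)
  | out {Γ Δ} {k : σ.NSort} (m : Name σ Δ k) {P Q : Tm σ Γ Δ (σ.obj k)} :
      InSubterm B P Q → InSubterm B (.out m P) (.out m Q)
  | parL {Γ Δ} {P P' : Tm σ Γ Δ .proc} (Q : Tm σ Γ Δ .proc) :
      InSubterm B P P' → InSubterm B (.par P Q) (.par P' Q)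
  | parR {Γ Δ} (P : Tm σ Γ Δ .proc) {Q Q' : Tm σ Γ Δ .proc} :
      InSubterm B Q Q' → InSubterm B (.par P Q) (.par P Q')
  | pabs {Γ Δ S} {P Q : Tm σ (S :: Γ) Δ .proc} :
      InSubterm B P Q → InSubterm B (.pabs P) (.pabs Q)
  | pappL {Γ Δ S} {P P' : Tm σ Γ Δ (.pabs S)} (Q : Tm σ Γ Δ S) :
      InSubterm B P P' → InSubterm B (.papp P Q) (.papp P' Q)
  | pappR {Γ Δ S} (P : Tm σ Γ Δ (.pabs S)) {Q Q' : Tm σ Γ Δ S} :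
      InSubterm B Q Q' → InSubterm B (.papp P Q) (.papp P Q')
  | nabs {Γ Δ k} {P Q : Tm σ Γ (k :: Δ) .proc} :
      InSubterm B P Q → InSubterm B (.nabs P) (.nabs Q)
  | napp {Γ Δ k} {P P' : Tm σ Γ Δ (.nabs k)} (n : Name σ Δ k) :
      InSubterm B P P' → InSubterm B (.napp P n) (.napp P' n)

/-- Structural congruence `≡`: the smallest congruence with the commutative monoid laws for
parallel composition and the application laws. -/
def SCongr : TRel σ := Cong fun _ _ _ P Q => MonoidLaw P Q ∨ AppLaw P Q

/-- The congruence generated by the commutative monoid laws alone. -/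
def MCongr : TRel σ := Cong MonoidLaw

/-- Provable equality in the axiom system: the commutative monoid laws, `DIS`, `APP1`, `APP2`. -/
def AxEq : TRel σ := Cong fun _ _ _ P Q => MonoidLaw P Q ∨ DisLaw P Q ∨ AppLaw P Q

/-- `P ⇝ Q`: up to the monoid laws, `Q` is obtained from `P` by rewriting a subterm by `DIS`,
`APP1` or `APP2` from left to right. -/
def Rewrites : TRel σ := fun Γ Δ T P Q =>
  ∃ P' Q' : Tm σ Γ Δ T, MCongr P P' ∧
    InSubterm (fun _ _ _ A B => DisLaw A B ∨ AppLaw A B) P' Q' ∧ MCongr Q' Q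

/-- `P` is in normal form: no `⇝`-step is possible. -/
def IsNormal {Γ Δ T} (P : Tm σ Γ Δ T) : Prop := ∀ Q : Tm σ Γ Δ T, ¬ Rewrites P Q

/-- `N` is a normal form of `P`. -/
def NormalFormOf {Γ Δ T} (N P : Tm σ Γ Δ T) : Prop :=
  Relation.ReflTransGen (fun A B : Tm σ Γ Δ T => Rewrites A B) P N ∧ IsNormal N

end Laws

section Bisimilarity

variable {σ : Sorting.{u}}

/-- Output transitions: `OutTr m A P P'` says that `P` outputs `A` on `m` and becomes `P'`. -/
inductive OutTr {Γ : List (Ty σ.NSort)} {Δ : List σ.NSort} {k : σ.NSort}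
    (m : Name σ Δ k) (A : Tm σ Γ Δ (σ.obj k)) : Tm σ Γ Δ .proc → Tm σ Γ Δ .proc → Prop
  | out : OutTr m A (.out m A) .nil
  | parL {P P'} (Q : Tm σ Γ Δ .proc) : OutTr m A P P' → OutTr m A (.par P Q) (.par P' Q)
  | parR {Q Q'} (P : Tm σ Γ Δ .proc) : OutTr m A Q Q' → OutTr m A (.par P Q) (.par P Q')
  | struct {Q P P' Q'} : SCongr Q P → OutTr m A P P' → SCongr P' Q' → OutTr m A Q Q'

/-- Input transitions (late style): `InpTr m P P'` says that `P` inputs on `m` and becomes `P'`, in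
which the most recent process variable is the place-holder `X`. Weakening in the rules for parallel
composition is the condition that `X` is not free in the other component. -/
inductive InpTr {Γ : List (Ty σ.NSort)} {Δ : List σ.NSort} {k : σ.NSort}
    (m : Name σ Δ k) : Tm σ Γ Δ .proc → Tm σ (σ.obj k :: Γ) Δ .proc → Prop
  | inp (P : Tm σ (σ.obj k :: Γ) Δ .proc) : InpTr m (.inp m P) P
  | parL {P P'} (Q : Tm σ Γ Δ .proc) : InpTr m P P' → InpTr m (.par P Q) (.par P' Q.wkP)
  | parR {Q Q'} (P : Tm σ Γ Δ .proc) : InpTr m Q Q' → InpTr m (.par P Q) (.par P.wkP Q')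
  | struct {Q P P' Q'} : SCongr Q P → InpTr m P P' → SCongr P' Q' → InpTr m Q Q'

/-- Strong HO-IO bisimulations. Interaction (`τ`) transitions play no role in this notion. -/
structure IsHOIOBisim (R : TRel σ) : Prop where
  symm : ∀ {Γ Δ T} {P Q : Tm σ Γ Δ T}, R P Q → R Q P
  nonabs : ∀ {Γ Δ T} {P Q : Tm σ Γ Δ T}, R P Q → ¬ P.IsAbs → ¬ Q.IsAbs
  pabs : ∀ {Γ Δ S} {A : Tm σ (S :: Γ) Δ .proc} {Q : Tm σ Γ Δ (.pabs S)}, R (.pabs A) Q →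
    ∃ B, Q = .pabs B ∧ R A B
  nabs : ∀ {Γ Δ k} {A : Tm σ Γ (k :: Δ) .proc} {Q : Tm σ Γ Δ (.nabs k)}, R (.nabs A) Q →
    ∃ B, Q = .nabs B ∧ R A B
  out : ∀ {Γ Δ} {P Q : Tm σ Γ Δ .proc}, R P Q →
    ∀ {k} (m : Name σ Δ k) (A : Tm σ Γ Δ (σ.obj k)) (P' : Tm σ Γ Δ .proc), OutTr m A P P' →
      ∃ B Q', OutTr m B Q Q' ∧ R A B ∧ R P' Q'
  inp : ∀ {Γ Δ} {P Q : Tm σ Γ Δ .proc}, R P Q →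
    ∀ {k} (m : Name σ Δ k) (P' : Tm σ (σ.obj k :: Γ) Δ .proc), InpTr m P P' →
      ∃ Q', InpTr m Q Q' ∧ R P' Q'
  var : ∀ {Γ Δ} {P Q : Tm σ Γ Δ .proc}, R P Q →
    ∀ (X : Var Γ .proc) (P' : Tm σ Γ Δ .proc), SCongr P (.par (.var X) P') →
      ∃ Q', SCongr Q (.par (.var X) Q') ∧ R P' Q'
  /-- The previous clause for a variable `X` of abstraction type: `X` has no parallel component
  but the implicit `0`, and it is matched by `X`. -/
  varAbs : ∀ {Γ Δ T} (X : Var Γ T) {Q : Tm σ Γ Δ T}, T ≠ .proc → R (.var X) Q → SCongr Q (.var X)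
  varPapp : ∀ {Γ Δ} {P Q : Tm σ Γ Δ .proc}, R P Q →
    ∀ {S} (X : Var Γ (.pabs S)) (A : Tm σ Γ Δ S) (P' : Tm σ Γ Δ .proc),
      SCongr P (.par (.papp (.var X) A) P') →
        ∃ B Q', SCongr Q (.par (.papp (.var X) B) Q') ∧ R A B ∧ R P' Q'
  varNapp : ∀ {Γ Δ} {P Q : Tm σ Γ Δ .proc}, R P Q →
    ∀ {k} (X : Var Γ (.nabs k)) (n : Name σ Δ k) (P' : Tm σ Γ Δ .proc),
      SCongr P (.par (.napp (.var X) n) P') →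
        ∃ Q', SCongr Q (.par (.napp (.var X) n) Q') ∧ R P' Q'

/-- Strong bisimilarity `∼`: the largest strong HO-IO bisimulation. -/
def Bisim : TRel σ := fun _ _ _ P Q => ∃ R : TRel σ, IsHOIOBisim R ∧ R P Q

end Bisimilarity

end HOmp

/-!
Complete developments of `APP1` and `APP2` commute with the commutative monoid laws and `DIS`, so
every provable equality descends to β-normal forms, where only the monoid laws and `DIS` remain.

*Soundness.* The prime components of provably equal β-normal processes match up to provable
equality: `DIS` merely relates an input `m(X).(P | ∏ m(X).P)` to copies of `m(X).P`, and both sides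
have the same derivatives. Since transitions can be read off from the prime components of the
β-normal form, provable equality is a bisimulation.

*Completeness.* Bisimilar normal forms are shown to be equal up to the monoid laws by induction on
their total size; the induction hypothesis turns the components and derivatives of matching prime
components into equal ones. A component other than an input then cancels at once. If all components
are inputs, compare the numbers of copies of a largest component `F`: the body of an input is
smaller than the input, so performing an input other than `F` leaves the copies of `F` untouched.
Either the two processes agree, or one of them is a single input which `DIS` expands into the
other, and this is excluded by normality.

*Normal forms.* β-normal forms are computed by hereditary substitution, which terminates as the type
of the substituted variable decreases. On β-normal terms `DIS` decreases a weight in which an input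
counts for twice its body plus one.
-/

namespace HOmp

universe u

section Substitution

variable {σ : Sorting.{u}} {Γ Γ' Γ'' : List (Ty σ.NSort)} {Δ Δ' Δ'' : List σ.NSort}
  {S T : Ty σ.NSort} {k : σ.NSort}

theorem Name.sub_id (m : Name σ Δ k) : m.sub (fun _ x => .var x) = m := by
  cases m <;> rfl

theorem Name.sub_sub (m : Name σ Δ k) (ν : NSub σ Δ Δ') (ν' : NSub σ Δ' Δ'') :
    (m.sub ν).sub ν' = m.sub (fun _ x => (ν x).sub ν') := by
  cases m <;> rfl

theorem NSub.lift_id :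
    NSub.lift (k := k) (fun _ (x : Var Δ _) => .var x) = fun _ x => .var x := by
  funext _ x; cases x <;> rfl

theorem NSub.lift_comp (ν : NSub σ Δ Δ') (ν' : NSub σ Δ' Δ'') :
    (fun _ x => (NSub.lift (k := k) ν x).sub (NSub.lift ν')) =
      NSub.lift (fun _ x => (ν x).sub ν') := by
  funext _ x
  cases x with
  | z => rfl
  | s x =>
    simp only [NSub.lift, Name.sub_sub]
    rfl

theorem PRen.lift_id : PRen.lift (S := S) (fun _ (x : Var Γ _) => x) = fun _ x => x := by
  funext _ x; cases x <;> rfl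

theorem PRen.lift_comp (ρ : PRen σ Γ Γ') (ρ' : PRen σ Γ' Γ'') :
    (fun _ x => PRen.lift (S := S) ρ' (PRen.lift ρ x)) = PRen.lift (fun _ x => ρ' (ρ x)) := by
  funext _ x; cases x <;> rfl

theorem Tm.ren_id (P : Tm σ Γ Δ T) : P.ren (fun _ x => x) (fun _ x => .var x) = P := by
  induction P <;> simp only [Tm.ren, Name.sub_id, PRen.lift_id, NSub.lift_id, *]

theorem Tm.ren_ren (P : Tm σ Γ Δ T) (ρ : PRen σ Γ Γ') (ν : NSub σ Δ Δ') (ρ' : PRen σ Γ' Γ'')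
    (ν' : NSub σ Δ' Δ'') :
    (P.ren ρ ν).ren ρ' ν' = P.ren (fun _ x => ρ' (ρ x)) (fun _ x => (ν x).sub ν') := by
  induction P generalizing Γ' Γ'' Δ' Δ'' <;>
    simp only [Tm.ren, Name.sub_sub, PRen.lift_comp, NSub.lift_comp, *]

/-- Simultaneous substitution of terms for process variables and of names for name variables. It
subsumes `Tm.ren`, `Tm.sub`, `Tm.psubst` and `Tm.nsubst`, so that one composition law,
`Tm.msub_msub`, yields the substitution lemmas for all of them. -/
def Tm.msub {Γ : List (Ty σ.NSort)} {Δ : List σ.NSort} {T : Ty σ.NSort} (P : Tm σ Γ Δ T)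
    {Γ' : List (Ty σ.NSort)} {Δ' : List σ.NSort} (θ : PSub σ Γ Γ' Δ') (ν : NSub σ Δ Δ') :
    Tm σ Γ' Δ' T :=
  match P with
  | .nil => .nil
  | .var x => θ x
  | .inp m P => .inp (m.sub ν) (P.msub (PSub.liftP θ) ν)
  | .out m Q => .out (m.sub ν) (Q.msub θ ν)
  | .par P Q => .par (P.msub θ ν) (Q.msub θ ν)
  | .pabs P => .pabs (P.msub (PSub.liftP θ) ν)
  | .papp P Q => .papp (P.msub θ ν) (Q.msub θ ν)
  | .nabs P => .nabs (P.msub (PSub.liftN θ) (NSub.lift ν))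
  | .napp P n => .napp (P.msub θ ν) (n.sub ν)

theorem PSub.liftP_var (ρ : PRen σ Γ Γ') :
    PSub.liftP (S := S) (fun _ x => Tm.var (Δ := Δ) (ρ x)) = fun _ x => .var (PRen.lift ρ x) := by
  funext _ x; cases x <;> rfl

theorem PSub.liftN_var (ρ : PRen σ Γ Γ') :
    PSub.liftN (k := k) (fun _ x => Tm.var (Δ := Δ) (ρ x)) = fun _ x => .var (ρ x) :=
  rfl

theorem Tm.sub_eq_msub (P : Tm σ Γ Δ T) (θ : PSub σ Γ Γ' Δ) :
    P.sub θ = P.msub θ (fun _ x => .var x) := by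
  induction P generalizing Γ' <;> simp only [Tm.sub, Tm.msub, Name.sub_id, NSub.lift_id, *]

theorem Tm.ren_eq_msub (P : Tm σ Γ Δ T) (ρ : PRen σ Γ Γ') (ν : NSub σ Δ Δ') :
    P.ren ρ ν = P.msub (fun _ x => .var (ρ x)) ν := by
  induction P generalizing Γ' Δ' <;>
    simp only [Tm.ren, Tm.msub, PSub.liftP_var, PSub.liftN_var, *]

theorem PRen.lift_liftP (ρ : PRen σ Γ Γ') (θ : PSub σ Γ' Γ'' Δ) :
    (fun _ x => PSub.liftP (S := S) θ (PRen.lift ρ x)) = PSub.liftP (fun _ x => θ (ρ x)) := by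
  funext _ x; cases x <;> rfl

theorem PRen.liftN_comp (ρ : PRen σ Γ Γ') (θ : PSub σ Γ' Γ'' Δ) :
    (fun _ x => PSub.liftN (k := k) θ (ρ x)) = PSub.liftN (fun _ x => θ (ρ x)) :=
  rfl

theorem Tm.msub_ren (P : Tm σ Γ Δ T) (ρ : PRen σ Γ Γ') (ν : NSub σ Δ Δ') (θ : PSub σ Γ' Γ'' Δ'')
    (ν' : NSub σ Δ' Δ'') :
    (P.ren ρ ν).msub θ ν' = P.msub (fun _ x => θ (ρ x)) (fun _ x => (ν x).sub ν') := by
  induction P generalizing Γ' Γ'' Δ' Δ'' <;>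
    simp only [Tm.ren, Tm.msub, Name.sub_sub, PRen.lift_liftP, PRen.liftN_comp, NSub.lift_comp, *]

theorem Tm.msub_id (P : Tm σ Γ Δ T) : P.msub (fun _ x => .var x) (fun _ x => .var x) = P := by
  rw [← Tm.ren_eq_msub P (fun _ x => x), Tm.ren_id]

theorem Tm.ren_wkP (P : Tm σ Γ Δ T) (ρ : PRen σ Γ Γ') (ν : NSub σ Δ Δ') :
    (P.wkP (S := S)).ren (PRen.lift ρ) ν = (P.ren ρ ν).wkP := by
  simp only [Tm.wkP, Tm.ren_ren, PRen.lift]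
  congr; funext _ x; exact (Name.sub_id _).symm

theorem PSub.liftP_ren (θ : PSub σ Γ Γ' Δ) (ρ : PRen σ Γ' Γ'') (ν : NSub σ Δ Δ') :
    (fun _ x => (PSub.liftP (S := S) θ x).ren (PRen.lift ρ) ν) =
      PSub.liftP (fun _ x => (θ x).ren ρ ν) := by
  funext _ x
  cases x with
  | z => rfl
  | s x => exact Tm.ren_wkP (θ x) ρ ν

theorem PSub.liftN_ren (θ : PSub σ Γ Γ' Δ) (ρ : PRen σ Γ' Γ'') (ν : NSub σ Δ Δ') :
    (fun _ x => (PSub.liftN (k := k) θ x).ren ρ (NSub.lift ν)) =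
      PSub.liftN (fun _ x => (θ x).ren ρ ν) := by
  funext _ x
  simp only [PSub.liftN, Tm.wkN, Tm.ren_ren]
  rfl

theorem Tm.ren_msub (P : Tm σ Γ Δ T) (θ : PSub σ Γ Γ' Δ') (ν : NSub σ Δ Δ') (ρ : PRen σ Γ' Γ'')
    (ν' : NSub σ Δ' Δ'') :
    (P.msub θ ν).ren ρ ν' = P.msub (fun _ x => (θ x).ren ρ ν') (fun _ x => (ν x).sub ν') := by
  induction P generalizing Γ' Γ'' Δ' Δ'' <;>
    simp only [Tm.ren, Tm.msub, Name.sub_sub, PSub.liftP_ren, PSub.liftN_ren, NSub.lift_comp, *]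

theorem Tm.msub_wkP (P : Tm σ Γ Δ T) (θ : PSub σ Γ Γ' Δ') (ν : NSub σ Δ Δ') :
    (P.wkP (S := S)).msub (PSub.liftP θ) ν = (P.msub θ ν).wkP := by
  simp only [Tm.wkP, Tm.msub_ren, Tm.ren_msub, PSub.liftP]
  congr; funext _ x; exact (Name.sub_id _).symm

theorem PSub.liftP_msub (θ : PSub σ Γ Γ' Δ) (θ' : PSub σ Γ' Γ'' Δ') (ν : NSub σ Δ Δ') :
    (fun _ x => (PSub.liftP (S := S) θ x).msub (PSub.liftP θ') ν) =
      PSub.liftP (fun _ x => (θ x).msub θ' ν) := by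
  funext _ x
  cases x with
  | z => rfl
  | s x => exact Tm.msub_wkP (θ x) θ' ν

theorem PSub.liftN_msub (θ : PSub σ Γ Γ' Δ) (θ' : PSub σ Γ' Γ'' Δ') (ν : NSub σ Δ Δ') :
    (fun _ x => (PSub.liftN (k := k) θ x).msub (PSub.liftN θ') (NSub.lift ν)) =
      PSub.liftN (fun _ x => (θ x).msub θ' ν) := by
  funext _ x
  simp only [PSub.liftN, Tm.wkN, Tm.msub_ren, Tm.ren_msub]
  rfl

theorem Tm.msub_msub (P : Tm σ Γ Δ T) (θ : PSub σ Γ Γ' Δ') (ν : NSub σ Δ Δ')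
    (θ' : PSub σ Γ' Γ'' Δ'') (ν' : NSub σ Δ' Δ'') :
    (P.msub θ ν).msub θ' ν' = P.msub (fun _ x => (θ x).msub θ' ν') (fun _ x => (ν x).sub ν') := by
  induction P generalizing Γ' Γ'' Δ' Δ'' <;>
    simp only [Tm.msub, Name.sub_sub, PSub.liftP_msub, PSub.liftN_msub, NSub.lift_comp, *]

theorem Tm.psubst_wkP (P : Tm σ Γ Δ T) (Q : Tm σ Γ Δ S) : P.wkP.psubst Q = P := by
  simp only [Tm.wkP, Tm.psubst, Tm.sub_eq_msub, Tm.msub_ren]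
  exact Tm.msub_id P

theorem Tm.nsubst_wkN (P : Tm σ Γ Δ T) (m : Name σ Δ k) : P.wkN.nsubst m = P := by
  simp only [Tm.wkN, Tm.nsubst, Tm.ren_ren]
  exact Tm.ren_id P

theorem Tm.nsubst_eq_msub (P : Tm σ Γ (k :: Δ) T) (m : Name σ Δ k) :
    P.nsubst m = P.msub (fun _ x => .var x) (NSub.single m) :=
  Tm.ren_eq_msub _ _ _

theorem Tm.msub_psubst (P : Tm σ (S :: Γ) Δ T) (Q : Tm σ Γ Δ S) (θ : PSub σ Γ Γ' Δ')
    (ν : NSub σ Δ Δ') :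
    (P.psubst Q).msub θ ν = (P.msub (PSub.liftP θ) ν).psubst (Q.msub θ ν) := by
  simp only [Tm.psubst, Tm.sub_eq_msub, Tm.msub_msub]
  congr
  · funext _ x
    cases x with
    | z => rfl
    | s x =>
      simp only [PSub.liftP, ← Tm.sub_eq_msub]
      exact (Tm.psubst_wkP (θ x) (Q.msub θ ν)).symm
  · funext _ x; exact (Name.sub_id _).symm

theorem Tm.msub_nsubst (P : Tm σ Γ (k :: Δ) T) (m : Name σ Δ k) (θ : PSub σ Γ Γ' Δ')
    (ν : NSub σ Δ Δ') :
    (P.nsubst m).msub θ ν = (P.msub (PSub.liftN θ) (NSub.lift ν)).nsubst (m.sub ν) := by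
  simp only [Tm.nsubst_eq_msub, Tm.msub_msub]
  congr
  · funext _ x
    simp only [PSub.liftN, ← Tm.nsubst_eq_msub]
    exact (Tm.nsubst_wkN (θ x) (m.sub ν)).symm
  · funext _ x
    cases x with
    | z => rfl
    | s x =>
      simp only [NSub.single, NSub.lift, Name.sub_sub]
      exact (Name.sub_id _).symm

theorem Tm.ren_psubst (P : Tm σ (S :: Γ) Δ T) (Q : Tm σ Γ Δ S) (ρ : PRen σ Γ Γ')
    (ν : NSub σ Δ Δ') :
    (P.psubst Q).ren ρ ν = (P.ren (PRen.lift ρ) ν).psubst (Q.ren ρ ν) := by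
  simp only [Tm.ren_eq_msub, Tm.msub_psubst, PSub.liftP_var]

theorem Tm.ren_nsubst (P : Tm σ Γ (k :: Δ) T) (m : Name σ Δ k) (ρ : PRen σ Γ Γ')
    (ν : NSub σ Δ Δ') :
    (P.nsubst m).ren ρ ν = (P.ren ρ (NSub.lift ν)).nsubst (m.sub ν) := by
  simp only [Tm.ren_eq_msub, Tm.msub_nsubst, PSub.liftN_var]

theorem Tm.msub_copies (n : ℕ) (P : Tm σ Γ Δ .proc) (θ : PSub σ Γ Γ' Δ') (ν : NSub σ Δ Δ') :
    (Tm.copies n P).msub θ ν = Tm.copies n (P.msub θ ν) := by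
  induction n with
  | zero => rfl
  | succ n ih => simp only [Tm.copies, Tm.msub, ih]

end Substitution

section Development

variable {σ : Sorting.{u}} {Γ Γ' : List (Ty σ.NSort)} {Δ Δ' : List σ.NSort} {S T : Ty σ.NSort}
  {k : σ.NSort}

/-- Application of a term to a term, contracted if the function is an abstraction. -/
def Tm.pappRed : Tm σ Γ Δ (.pabs S) → Tm σ Γ Δ S → Tm σ Γ Δ .proc
  | .var x, Q => .papp (.var x) Q
  | .pabs P, Q => P.psubst Q

/-- Application of a term to a name, contracted if the function is an abstraction. -/
def Tm.nappRed : Tm σ Γ Δ (.nabs k) → Name σ Δ k → Tm σ Γ Δ .proc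
  | .var x, n => .napp (.var x) n
  | .nabs P, n => P.nsubst n

/-- The complete development: all application redexes of the term are contracted
simultaneously. -/
def Tm.dev {Γ : List (Ty σ.NSort)} {Δ : List σ.NSort} {T : Ty σ.NSort} :
    Tm σ Γ Δ T → Tm σ Γ Δ T
  | .nil => .nil
  | .var x => .var x
  | .inp m P => .inp m P.dev
  | .out m Q => .out m Q.dev
  | .par P Q => .par P.dev Q.dev
  | .pabs P => .pabs P.dev
  | .papp P Q => P.dev.pappRed Q.dev
  | .nabs P => .nabs P.dev
  | .napp P n => P.dev.nappRed n

theorem Tm.ren_pappRed (P : Tm σ Γ Δ (.pabs S)) (Q : Tm σ Γ Δ S) (ρ : PRen σ Γ Γ')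
    (ν : NSub σ Δ Δ') : (P.pappRed Q).ren ρ ν = (P.ren ρ ν).pappRed (Q.ren ρ ν) := by
  cases P with
  | var x => rfl
  | pabs P => exact Tm.ren_psubst P Q ρ ν

theorem Tm.ren_nappRed (P : Tm σ Γ Δ (.nabs k)) (n : Name σ Δ k) (ρ : PRen σ Γ Γ')
    (ν : NSub σ Δ Δ') : (P.nappRed n).ren ρ ν = (P.ren ρ ν).nappRed (n.sub ν) := by
  cases P with
  | var x => rfl
  | nabs P => exact Tm.ren_nsubst P n ρ ν

theorem Tm.dev_ren (P : Tm σ Γ Δ T) (ρ : PRen σ Γ Γ') (ν : NSub σ Δ Δ') :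
    (P.ren ρ ν).dev = P.dev.ren ρ ν := by
  induction P generalizing Γ' Δ' <;>
    simp only [Tm.ren, Tm.dev, Tm.ren_pappRed, Tm.ren_nappRed, *]

theorem Tm.dev_wkP (P : Tm σ Γ Δ T) : (P.wkP (S := S)).dev = P.dev.wkP :=
  Tm.dev_ren P _ _

theorem Tm.dev_copies (n : ℕ) (P : Tm σ Γ Δ .proc) :
    (Tm.copies n P).dev = Tm.copies n P.dev := by
  induction n with
  | zero => rfl
  | succ n ih => simp only [Tm.copies, Tm.dev, ih]

end Development

section Congruence

variable {σ : Sorting.{u}}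

/-- Compatible relations on terms: those preserved by every term constructor. -/
structure Compatible (R : TRel σ) : Prop where
  nil : ∀ {Γ Δ}, R (Tm.nil (Γ := Γ) (Δ := Δ)) .nil
  var : ∀ {Γ Δ T} (x : Var Γ T), R (Tm.var (Δ := Δ) x) (.var x)
  inp : ∀ {Γ Δ k} (m : Name σ Δ k) {P Q : Tm σ (σ.obj k :: Γ) Δ .proc}, R P Q →
    R (.inp m P) (.inp m Q)
  out : ∀ {Γ Δ k} (m : Name σ Δ k) {P Q : Tm σ Γ Δ (σ.obj k)}, R P Q → R (.out m P) (.out m Q)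
  par : ∀ {Γ Δ} {P P' Q Q' : Tm σ Γ Δ .proc}, R P P' → R Q Q' → R (.par P Q) (.par P' Q')
  pabs : ∀ {Γ Δ S} {P Q : Tm σ (S :: Γ) Δ .proc}, R P Q → R (.pabs P) (.pabs Q)
  papp : ∀ {Γ Δ S} {P P' : Tm σ Γ Δ (.pabs S)} {Q Q' : Tm σ Γ Δ S}, R P P' → R Q Q' →
    R (.papp P Q) (.papp P' Q')
  nabs : ∀ {Γ Δ k} {P Q : Tm σ Γ (k :: Δ) .proc}, R P Q → R (.nabs P) (.nabs Q)
  napp : ∀ {Γ Δ k} {P P' : Tm σ Γ Δ (.nabs k)} (n : Name σ Δ k), R P P' →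
    R (.napp P n) (.napp P' n)

theorem Compatible.refl {R : TRel σ} (hR : Compatible R) {Γ Δ T} (P : Tm σ Γ Δ T) : R P P := by
  induction P with
  | nil => exact hR.nil
  | var x => exact hR.var x
  | inp m _ ih => exact hR.inp m ih
  | out m _ ih => exact hR.out m ih
  | par _ _ ih₁ ih₂ => exact hR.par ih₁ ih₂
  | pabs _ ih => exact hR.pabs ih
  | papp _ _ ih₁ ih₂ => exact hR.papp ih₁ ih₂
  | nabs _ ih => exact hR.nabs ih
  | napp _ n ih => exact hR.napp n ih

theorem Compatible.liftP {R : TRel σ} (hR : Compatible R)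
    (hren : ∀ {Γ Δ T} {P Q : Tm σ Γ Δ T}, R P Q →
      ∀ {Γ' Δ'} (ρ : PRen σ Γ Γ') (ν : NSub σ Δ Δ'), R (P.ren ρ ν) (Q.ren ρ ν))
    {Γ Γ' : List (Ty σ.NSort)} {Δ : List σ.NSort} {S} {θ θ' : PSub σ Γ Γ' Δ}
    (h : ∀ ⦃T⦄ (x : Var Γ T), R (θ x) (θ' x)) ⦃T⦄ (x : Var (S :: Γ) T) :
    R (PSub.liftP θ x) (PSub.liftP θ' x) := by
  cases x with
  | z => exact hR.var _
  | s x => exact hren (h x) _ _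

theorem Compatible.single {R : TRel σ} (hR : Compatible R) {Γ Δ S} {Q Q' : Tm σ Γ Δ S}
    (hQ : R Q Q') ⦃T⦄ (x : Var (S :: Γ) T) : R (PSub.single Q x) (PSub.single Q' x) := by
  cases x with
  | z => exact hQ
  | s x => exact hR.var x

theorem Compatible.msub {R : TRel σ} (hR : Compatible R)
    (hren : ∀ {Γ Δ T} {P Q : Tm σ Γ Δ T}, R P Q →
      ∀ {Γ' Δ'} (ρ : PRen σ Γ Γ') (ν : NSub σ Δ Δ'), R (P.ren ρ ν) (Q.ren ρ ν))
    {Γ Δ T} (P : Tm σ Γ Δ T) {Γ' Δ'} {θ θ' : PSub σ Γ Γ' Δ'} (ν : NSub σ Δ Δ')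
    (h : ∀ ⦃T⦄ (x : Var Γ T), R (θ x) (θ' x)) : R (P.msub θ ν) (P.msub θ' ν) := by
  induction P generalizing Γ' Δ' with
  | nil => exact hR.nil
  | var x => exact h x
  | inp m _ ih => exact hR.inp _ (ih ν (hR.liftP hren h))
  | out m _ ih => exact hR.out _ (ih ν h)
  | par _ _ ih₁ ih₂ => exact hR.par (ih₁ ν h) (ih₂ ν h)
  | pabs _ ih => exact hR.pabs (ih ν (hR.liftP hren h))
  | papp _ _ ih₁ ih₂ => exact hR.papp (ih₁ ν h) (ih₂ ν h)
  | nabs _ ih => exact hR.nabs (ih _ fun _ x => hren (h x) _ _)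
  | napp _ n ih => exact hR.napp _ (ih ν h)

theorem InSubterm.mono {B B' : TRel σ} (h : ∀ {Γ Δ T} {P Q : Tm σ Γ Δ T}, B P Q → B' P Q)
    {Γ Δ T} {P Q : Tm σ Γ Δ T} (hPQ : InSubterm B P Q) : InSubterm B' P Q := by
  induction hPQ with
  | here hb => exact .here (h hb)
  | inp m _ ih => exact ih.inp m
  | out m _ ih => exact ih.out m
  | parL Q _ ih => exact ih.parL Q
  | parR P _ ih => exact ih.parR P
  | pabs _ ih => exact ih.pabs
  | pappL Q _ ih => exact ih.pappL Q
  | pappR P _ ih => exact ih.pappR P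
  | nabs _ ih => exact ih.nabs
  | napp n _ ih => exact ih.napp n

theorem Compatible.of_inSubterm {B R : TRel σ} (hR : Compatible R)
    (hB : ∀ {Γ Δ T} {P Q : Tm σ Γ Δ T}, B P Q → R P Q) {Γ Δ T} {P Q : Tm σ Γ Δ T}
    (h : InSubterm B P Q) : R P Q := by
  induction h with
  | here hb => exact hB hb
  | inp m _ ih => exact hR.inp m ih
  | out m _ ih => exact hR.out m ih
  | parL Q _ ih => exact hR.par ih (hR.refl Q)
  | parR P _ ih => exact hR.par (hR.refl P) ih
  | pabs _ ih => exact hR.pabs ih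
  | pappL Q _ ih => exact hR.papp ih (hR.refl Q)
  | pappR P _ ih => exact hR.papp (hR.refl P) ih
  | nabs _ ih => exact hR.nabs ih
  | napp n _ ih => exact hR.napp n ih

theorem Cong.compatible (B : TRel σ) : Compatible (Cong B) where
  nil := .refl _
  var _ := .refl _
  inp m _ _ h := h.inp m
  out m _ _ h := h.out m
  par h h' := h.par h'
  pabs h := h.pabs
  papp h h' := h.papp h'
  nabs h := h.nabs
  napp n h := h.napp n

/-- `P` and `Q` are the same variable, abstractions of the same kind with related bodies, or
arbitrary processes. -/
inductive HeadMatch (R : TRel σ) : TRel σ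
  | proc {Γ Δ} (P Q : Tm σ Γ Δ .proc) : HeadMatch R P Q
  | var {Γ Δ T} (x : Var Γ T) : HeadMatch R (Tm.var (Δ := Δ) x) (.var x)
  | pabs {Γ Δ S} {P Q : Tm σ (S :: Γ) Δ .proc} : R P Q → HeadMatch R (.pabs P) (.pabs Q)
  | nabs {Γ Δ k} {P Q : Tm σ Γ (k :: Δ) .proc} : R P Q → HeadMatch R (.nabs P) (.nabs Q)

theorem Cong.headMatch {B : TRel σ} (hB : ∀ {Γ Δ T} {P Q : Tm σ Γ Δ T}, B P Q → T = .proc)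
    {Γ Δ T} {P Q : Tm σ Γ Δ T} (h : Cong B P Q) : HeadMatch (Cong B) P Q := by
  induction h with
  | base h => cases hB h; exact .proc _ _
  | refl P =>
    cases P
    case var => exact .var _
    case pabs => exact .pabs (.refl _)
    case nabs => exact .nabs (.refl _)
    all_goals exact .proc _ _
  | symm _ ih =>
    cases ih with
    | proc => exact .proc _ _
    | var => exact .var _
    | pabs h => exact .pabs h.symm
    | nabs h => exact .nabs h.symm
  | trans _ _ ih₁ ih₂ =>
    cases ih₁ with
    | proc => exact .proc _ _
    | var => exact ih₂
    | pabs h => cases ih₂ with | pabs h' => exact .pabs (h.trans h')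
    | nabs h => cases ih₂ with | nabs h' => exact .nabs (h.trans h')
  | pabs h => exact .pabs h
  | nabs h => exact .nabs h
  | inp | out | par | papp | napp => exact .proc _ _

/-- Laws between processes that are closed under substitution and complete development. -/
structure Stable (B : TRel σ) : Prop where
  proc : ∀ {Γ Δ T} {P Q : Tm σ Γ Δ T}, B P Q → T = .proc
  msub : ∀ {Γ Δ T} {P Q : Tm σ Γ Δ T}, B P Q → ∀ {Γ' Δ'} (θ : PSub σ Γ Γ' Δ') (ν : NSub σ Δ Δ'),
    B (P.msub θ ν) (Q.msub θ ν)
  dev : ∀ {Γ Δ T} {P Q : Tm σ Γ Δ T}, B P Q → B P.dev Q.dev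

theorem Cong.mono {B B' : TRel σ} (h : ∀ {Γ Δ T} {P Q : Tm σ Γ Δ T}, B P Q → B' P Q)
    {Γ Δ T} {P Q : Tm σ Γ Δ T} (hPQ : Cong B P Q) : Cong B' P Q := by
  induction hPQ with
  | base hb => exact .base (h hb)
  | refl P => exact .refl P
  | symm _ ih => exact ih.symm
  | trans _ _ ih₁ ih₂ => exact ih₁.trans ih₂
  | inp m _ ih => exact ih.inp m
  | out m _ ih => exact ih.out m
  | par _ _ ih₁ ih₂ => exact ih₁.par ih₂
  | pabs _ ih => exact ih.pabs
  | papp _ _ ih₁ ih₂ => exact ih₁.papp ih₂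
  | nabs _ ih => exact ih.nabs
  | napp n _ ih => exact ih.napp n

theorem Cong.msub {B : TRel σ}
    (hB : ∀ {Γ Δ T} {P Q : Tm σ Γ Δ T}, B P Q →
      ∀ {Γ' Δ'} (θ : PSub σ Γ Γ' Δ') (ν : NSub σ Δ Δ'), B (P.msub θ ν) (Q.msub θ ν))
    {Γ Δ T} {P Q : Tm σ Γ Δ T} (h : Cong B P Q) {Γ' Δ'} (θ : PSub σ Γ Γ' Δ') (ν : NSub σ Δ Δ') :
    Cong B (P.msub θ ν) (Q.msub θ ν) := by
  induction h generalizing Γ' Δ' with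
  | base hb => exact .base (hB hb θ ν)
  | refl P => exact .refl _
  | symm _ ih => exact (ih θ ν).symm
  | trans _ _ ih₁ ih₂ => exact (ih₁ θ ν).trans (ih₂ θ ν)
  | inp m _ ih => exact (ih _ _).inp _
  | out m _ ih => exact (ih _ _).out _
  | par _ _ ih₁ ih₂ => exact (ih₁ _ _).par (ih₂ _ _)
  | pabs _ ih => exact (ih _ _).pabs
  | papp _ _ ih₁ ih₂ => exact (ih₁ _ _).papp (ih₂ _ _)
  | nabs _ ih => exact (ih _ _).nabs
  | napp n _ ih => exact (ih _ _).napp _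

section

variable {B : TRel σ} (hB : Stable B)
include hB

theorem Cong.ren {Γ Δ T} {P Q : Tm σ Γ Δ T} (h : Cong B P Q) {Γ' Δ'} (ρ : PRen σ Γ Γ')
    (ν : NSub σ Δ Δ') : Cong B (P.ren ρ ν) (Q.ren ρ ν) := by
  rw [Tm.ren_eq_msub, Tm.ren_eq_msub]
  exact h.msub hB.msub _ _

theorem Cong.wkP {Γ Δ T S} {P Q : Tm σ Γ Δ T} (h : Cong B P Q) :
    Cong B (P.wkP (S := S)) Q.wkP :=
  h.ren hB _ _

theorem Cong.psubst {Γ Δ S T} {P P' : Tm σ (S :: Γ) Δ T} {Q Q' : Tm σ Γ Δ S} (hP : Cong B P P')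
    (hQ : Cong B Q Q') : Cong B (P.psubst Q) (P'.psubst Q') := by
  simp only [Tm.psubst, Tm.sub_eq_msub]
  exact (hP.msub hB.msub _ _).trans
    ((Cong.compatible B).msub (Cong.ren hB) P' _ ((Cong.compatible B).single hQ))

theorem Cong.pappRed {Γ Δ S} {P P' : Tm σ Γ Δ (.pabs S)} {Q Q' : Tm σ Γ Δ S} (hP : Cong B P P')
    (hQ : Cong B Q Q') : Cong B (P.pappRed Q) (P'.pappRed Q') := by
  cases hP.headMatch hB.proc with
  | var x => exact (Cong.refl _).papp hQ
  | pabs hA => exact hA.psubst hB hQ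

theorem Cong.nappRed {Γ Δ k} {P P' : Tm σ Γ Δ (.nabs k)} (hP : Cong B P P') (n : Name σ Δ k) :
    Cong B (P.nappRed n) (P'.nappRed n) := by
  cases hP.headMatch hB.proc with
  | var x => exact .refl _
  | nabs hA => exact hA.ren hB _ _

theorem Cong.dev {Γ Δ T} {P Q : Tm σ Γ Δ T} (h : Cong B P Q) : Cong B P.dev Q.dev := by
  induction h with
  | base hb => exact .base (hB.dev hb)
  | refl P => exact .refl _
  | symm _ ih => exact ih.symm
  | trans _ _ ih₁ ih₂ => exact ih₁.trans ih₂
  | inp m _ ih => exact ih.inp m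
  | out m _ ih => exact ih.out m
  | par _ _ ih₁ ih₂ => exact ih₁.par ih₂
  | pabs _ ih => exact ih.pabs
  | papp _ _ ih₁ ih₂ => exact ih₁.pappRed hB ih₂
  | nabs _ ih => exact ih.nabs
  | napp n _ ih => exact ih.nappRed hB n

end

/-- The monoid laws and `DIS`: the laws that are left between β-normal terms. -/
def MonoidDisLaw : TRel σ := fun _ _ _ P Q => MonoidLaw P Q ∨ DisLaw P Q

theorem stable_monoidLaw : Stable (MonoidLaw (σ := σ)) where
  proc h := by cases h <;> rfl
  msub h _ _ θ ν := by
    cases h with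
    | assoc => exact .assoc _ _ _
    | comm => exact .comm _ _
    | unit => exact .unit _
  dev h := by
    cases h with
    | assoc => exact .assoc _ _ _
    | comm => exact .comm _ _
    | unit => exact .unit _

theorem DisLaw.msub {Γ Δ T} {P Q : Tm σ Γ Δ T} (h : DisLaw P Q) {Γ' Δ'} (θ : PSub σ Γ Γ' Δ')
    (ν : NSub σ Δ Δ') : DisLaw (P.msub θ ν) (Q.msub θ ν) := by
  cases h with
  | dis m P k hk =>
    simp only [Tm.msub, Tm.msub_copies, Tm.msub_wkP]
    exact .dis (m.sub ν) (P.msub (PSub.liftP θ) ν) k hk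

theorem stable_monoidDisLaw : Stable (MonoidDisLaw (σ := σ)) where
  proc h := h.elim (fun h => by cases h <;> rfl) (fun h => by cases h; rfl)
  msub h _ _ θ ν := h.imp (fun h => stable_monoidLaw.msub h θ ν) (fun h => h.msub θ ν)
  dev h := by
    refine h.imp (fun h => stable_monoidLaw.dev h) fun h => ?_
    cases h with
    | dis m P k hk =>
      simp only [Tm.dev, Tm.dev_copies, Tm.dev_wkP]
      exact .dis m P.dev k hk

end Congruence

section ParallelReduction

variable {σ : Sorting.{u}}

/-- Parallel reduction: some of the application redexes of a term are contracted. -/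
inductive ParRed : TRel σ
  | nil {Γ Δ} : ParRed (Tm.nil (Γ := Γ) (Δ := Δ)) .nil
  | var {Γ Δ T} (x : Var Γ T) : ParRed (Tm.var (Δ := Δ) x) (.var x)
  | inp {Γ Δ} {k : σ.NSort} (m : Name σ Δ k) {P Q : Tm σ (σ.obj k :: Γ) Δ .proc} :
      ParRed P Q → ParRed (.inp m P) (.inp m Q)
  | out {Γ Δ} {k : σ.NSort} (m : Name σ Δ k) {P Q : Tm σ Γ Δ (σ.obj k)} :
      ParRed P Q → ParRed (.out m P) (.out m Q)
  | par {Γ Δ} {P P' Q Q' : Tm σ Γ Δ .proc} :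
      ParRed P P' → ParRed Q Q' → ParRed (.par P Q) (.par P' Q')
  | pabs {Γ Δ S} {P Q : Tm σ (S :: Γ) Δ .proc} : ParRed P Q → ParRed (.pabs P) (.pabs Q)
  | papp {Γ Δ S} {P P' : Tm σ Γ Δ (.pabs S)} {Q Q' : Tm σ Γ Δ S} :
      ParRed P P' → ParRed Q Q' → ParRed (.papp P Q) (.papp P' Q')
  | nabs {Γ Δ k} {P Q : Tm σ Γ (k :: Δ) .proc} : ParRed P Q → ParRed (.nabs P) (.nabs Q)
  | napp {Γ Δ k} {P P' : Tm σ Γ Δ (.nabs k)} (n : Name σ Δ k) :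
      ParRed P P' → ParRed (.napp P n) (.napp P' n)
  | app1 {Γ Δ S} {P P' : Tm σ (S :: Γ) Δ .proc} {Q Q' : Tm σ Γ Δ S} :
      ParRed P P' → ParRed Q Q' → ParRed (.papp (.pabs P) Q) (P'.psubst Q')
  | app2 {Γ Δ k} {P P' : Tm σ Γ (k :: Δ) .proc} (m : Name σ Δ k) :
      ParRed P P' → ParRed (.napp (.nabs P) m) (P'.nsubst m)

theorem ParRed.compatible : Compatible (ParRed (σ := σ)) where
  nil := .nil
  var := .var
  inp m _ _ h := h.inp m
  out m _ _ h := h.out m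
  par h h' := h.par h'
  pabs h := h.pabs
  papp h h' := h.papp h'
  nabs h := h.nabs
  napp n h := h.napp n

theorem ParRed.refl {Γ Δ T} (P : Tm σ Γ Δ T) : ParRed P P :=
  ParRed.compatible.refl P

theorem ParRed.ren {Γ Δ T} {P Q : Tm σ Γ Δ T} (h : ParRed P Q) {Γ' Δ'} (ρ : PRen σ Γ Γ')
    (ν : NSub σ Δ Δ') : ParRed (P.ren ρ ν) (Q.ren ρ ν) := by
  induction h generalizing Γ' Δ' with
  | nil => exact .nil
  | var x => exact .var _
  | inp m _ ih => exact .inp _ (ih _ _)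
  | out m _ ih => exact .out _ (ih _ _)
  | par _ _ ih₁ ih₂ => exact .par (ih₁ _ _) (ih₂ _ _)
  | pabs _ ih => exact .pabs (ih _ _)
  | papp _ _ ih₁ ih₂ => exact .papp (ih₁ _ _) (ih₂ _ _)
  | nabs _ ih => exact .nabs (ih _ _)
  | napp n _ ih => exact .napp _ (ih _ _)
  | app1 _ _ ih₁ ih₂ => rw [Tm.ren_psubst]; exact .app1 (ih₁ _ _) (ih₂ _ _)
  | app2 m _ ih => rw [Tm.ren_nsubst]; exact .app2 _ (ih _ _)

theorem ParRed.msub {Γ Δ T} {P Q : Tm σ Γ Δ T} (hPQ : ParRed P Q) {Γ' Δ'}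
    {θ θ' : PSub σ Γ Γ' Δ'} (ν : NSub σ Δ Δ') (h : ∀ ⦃T⦄ (x : Var Γ T), ParRed (θ x) (θ' x)) :
    ParRed (P.msub θ ν) (Q.msub θ' ν) := by
  induction hPQ generalizing Γ' Δ' with
  | nil => exact .nil
  | var x => exact h x
  | inp m _ ih => exact .inp _ (ih _ (ParRed.compatible.liftP ParRed.ren h))
  | out m _ ih => exact .out _ (ih _ h)
  | par _ _ ih₁ ih₂ => exact .par (ih₁ _ h) (ih₂ _ h)
  | pabs _ ih => exact .pabs (ih _ (ParRed.compatible.liftP ParRed.ren h))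
  | papp _ _ ih₁ ih₂ => exact .papp (ih₁ _ h) (ih₂ _ h)
  | nabs _ ih => exact .nabs (ih _ fun _ x => (h x).ren _ _)
  | napp n _ ih => exact .napp _ (ih _ h)
  | app1 _ _ ih₁ ih₂ =>
    rw [Tm.msub_psubst]
    exact .app1 (ih₁ _ (ParRed.compatible.liftP ParRed.ren h)) (ih₂ _ h)
  | app2 m _ ih =>
    rw [Tm.msub_nsubst]
    exact .app2 _ (ih _ fun _ x => (h x).ren _ _)

theorem ParRed.psubst {Γ Δ S T} {P P' : Tm σ (S :: Γ) Δ T} {Q Q' : Tm σ Γ Δ S} (hP : ParRed P P')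
    (hQ : ParRed Q Q') : ParRed (P.psubst Q) (P'.psubst Q') := by
  simp only [Tm.psubst, Tm.sub_eq_msub]
  exact hP.msub _ (ParRed.compatible.single hQ)

theorem ParRed.triangle {Γ Δ T} {P Q : Tm σ Γ Δ T} (h : ParRed P Q) : ParRed Q P.dev := by
  induction h with
  | nil => exact .nil
  | var x => exact .var x
  | inp m _ ih => exact .inp m ih
  | out m _ ih => exact .out m ih
  | par _ _ ih₁ ih₂ => exact .par ih₁ ih₂
  | pabs _ ih => exact .pabs ih
  | @papp _ _ _ P P' Q Q' h₁ _ ih₁ ih₂ =>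
    cases h₁ with
    | var x => exact .papp (.var x) ih₂
    | pabs h => cases ih₁ with | pabs ih₁ => exact .app1 ih₁ ih₂
  | nabs _ ih => exact .nabs ih
  | @napp _ _ _ P P' n h₁ ih =>
    cases h₁ with
    | var x => exact .napp n (.var x)
    | nabs h => cases ih with | nabs ih => exact .app2 n ih
  | app1 _ _ ih₁ ih₂ => exact ih₁.psubst ih₂
  | app2 m _ ih => exact ih.ren _ _

theorem ParRed.dev_iterate {Γ Δ T} {P Q : Tm σ Γ Δ T} (h : ParRed P Q) (n : ℕ) :
    ParRed (Tm.dev^[n] P) (Tm.dev^[n] Q) := by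
  induction n generalizing P Q with
  | zero => exact h
  | succ _ ih => exact ih h.triangle.triangle

end ParallelReduction

section BetaNormal

variable {σ : Sorting.{u}}

/-- The term has no subterm that is an application of an abstraction. -/
def Tm.BetaNormal {Γ : List (Ty σ.NSort)} {Δ : List σ.NSort} {T : Ty σ.NSort} :
    Tm σ Γ Δ T → Prop
  | .nil => True
  | .var _ => True
  | .inp _ P => P.BetaNormal
  | .out _ Q => Q.BetaNormal
  | .par P Q => P.BetaNormal ∧ Q.BetaNormal
  | .pabs P => P.BetaNormal
  | .papp P Q => ¬ P.IsAbs ∧ Q.BetaNormal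
  | .nabs P => P.BetaNormal
  | .napp P _ => ¬ P.IsAbs

theorem Tm.eq_var_of_not_isAbs_pabs {Γ Δ S} {P : Tm σ Γ Δ (.pabs S)} (h : ¬ P.IsAbs) :
    ∃ x, P = .var x := by
  cases P with
  | var x => exact ⟨x, rfl⟩
  | pabs P => exact (h trivial).elim

theorem Tm.eq_var_of_not_isAbs_nabs {Γ Δ k} {P : Tm σ Γ Δ (.nabs k)} (h : ¬ P.IsAbs) :
    ∃ x, P = .var x := by
  cases P with
  | var x => exact ⟨x, rfl⟩
  | nabs P => exact (h trivial).elim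

theorem Tm.isAbs_ren {Γ Δ T} {P : Tm σ Γ Δ T} {Γ' Δ'} (ρ : PRen σ Γ Γ') (ν : NSub σ Δ Δ') :
    (P.ren ρ ν).IsAbs ↔ P.IsAbs := by
  cases P <;> exact Iff.rfl

theorem Tm.BetaNormal.ren {Γ Δ T} {P : Tm σ Γ Δ T} (h : P.BetaNormal) {Γ' Δ'} (ρ : PRen σ Γ Γ')
    (ν : NSub σ Δ Δ') : (P.ren ρ ν).BetaNormal := by
  induction P generalizing Γ' Δ' <;>
    simp_all only [Tm.ren, Tm.BetaNormal, Tm.isAbs_ren, not_false_eq_true, and_self]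

theorem Tm.BetaNormal.eq_of_parRed {Γ Δ T} {P Q : Tm σ Γ Δ T} (hP : P.BetaNormal)
    (h : ParRed P Q) : Q = P := by
  induction h with
  | nil => rfl
  | var x => rfl
  | inp m _ ih => rw [ih hP]
  | out m _ ih => rw [ih hP]
  | par _ _ ih₁ ih₂ => rw [ih₁ hP.1, ih₂ hP.2]
  | pabs _ ih => rw [ih hP]
  | papp _ _ ih₁ ih₂ =>
    obtain ⟨x, rfl⟩ := Tm.eq_var_of_not_isAbs_pabs hP.1
    rw [ih₁ trivial, ih₂ hP.2]
  | nabs _ ih => rw [ih hP]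
  | napp n _ ih =>
    obtain ⟨x, rfl⟩ := Tm.eq_var_of_not_isAbs_nabs hP
    rw [ih trivial]
  | app1 => exact (hP.1 trivial).elim
  | app2 => exact (hP trivial).elim

theorem Tm.BetaNormal.dev_iterate {Γ Δ T} {P : Tm σ Γ Δ T} (hP : P.BetaNormal) (n : ℕ) :
    Tm.dev^[n] P = P :=
  Function.iterate_fixed (hP.eq_of_parRed (ParRed.refl P).triangle) n

theorem AppLaw.parRed {Γ Δ T} {P Q : Tm σ Γ Δ T} (h : AppLaw P Q) : ParRed P Q := by
  cases h with
  | app1 P Q => exact .app1 (.refl P) (.refl Q)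
  | app2 P m => exact .app2 m (.refl P)

/-- Reduction of application redexes. -/
abbrev AppSteps {Γ Δ T} : Tm σ Γ Δ T → Tm σ Γ Δ T → Prop :=
  Relation.ReflTransGen (InSubterm AppLaw · ·)

namespace AppSteps

theorem inp {Γ Δ} {k : σ.NSort} (m : Name σ Δ k) {P Q : Tm σ (σ.obj k :: Γ) Δ .proc}
    (h : AppSteps P Q) : AppSteps (.inp m P) (.inp m Q) :=
  h.lift (Tm.inp m) fun _ _ => .inp m

theorem out {Γ Δ} {k : σ.NSort} (m : Name σ Δ k) {P Q : Tm σ Γ Δ (σ.obj k)}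
    (h : AppSteps P Q) : AppSteps (.out m P) (.out m Q) :=
  h.lift (Tm.out m) fun _ _ => .out m

theorem par {Γ Δ} {P P' Q Q' : Tm σ Γ Δ .proc} (h₁ : AppSteps P P') (h₂ : AppSteps Q Q') :
    AppSteps (.par P Q) (.par P' Q') :=
  (h₁.lift (Tm.par · Q) fun _ _ => .parL Q).trans (h₂.lift (Tm.par P' ·) fun _ _ => .parR P')

theorem pabs {Γ Δ S} {P Q : Tm σ (S :: Γ) Δ .proc} (h : AppSteps P Q) :
    AppSteps (.pabs P) (.pabs Q) :=
  h.lift Tm.pabs fun _ _ => .pabs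

theorem papp {Γ Δ S} {P P' : Tm σ Γ Δ (.pabs S)} {Q Q' : Tm σ Γ Δ S} (h₁ : AppSteps P P')
    (h₂ : AppSteps Q Q') : AppSteps (.papp P Q) (.papp P' Q') :=
  (h₁.lift (Tm.papp · Q) fun _ _ => .pappL Q).trans (h₂.lift (Tm.papp P' ·) fun _ _ => .pappR P')

theorem nabs {Γ Δ k} {P Q : Tm σ Γ (k :: Δ) .proc} (h : AppSteps P Q) :
    AppSteps (.nabs P) (.nabs Q) :=
  h.lift Tm.nabs fun _ _ => .nabs

theorem napp {Γ Δ k} {P P' : Tm σ Γ Δ (.nabs k)} (n : Name σ Δ k) (h : AppSteps P P') :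
    AppSteps (.napp P n) (.napp P' n) :=
  h.lift (Tm.napp · n) fun _ _ => .napp n

end AppSteps

/-- The term reduces to a β-normal term. -/
def Tm.HasBnf {Γ Δ T} (P : Tm σ Γ Δ T) : Prop :=
  ∃ N, N.BetaNormal ∧ AppSteps P N

namespace Tm.HasBnf

theorem of_appSteps {Γ Δ T} {P Q : Tm σ Γ Δ T} (h : AppSteps P Q) : Q.HasBnf → P.HasBnf
  | ⟨N, hN, hQ⟩ => ⟨N, hN, h.trans hQ⟩

theorem inp {Γ Δ} {k : σ.NSort} (m : Name σ Δ k) {P : Tm σ (σ.obj k :: Γ) Δ .proc} :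
    P.HasBnf → (Tm.inp m P).HasBnf
  | ⟨N, hN, h⟩ => ⟨.inp m N, hN, .inp m h⟩

theorem out {Γ Δ} {k : σ.NSort} (m : Name σ Δ k) {P : Tm σ Γ Δ (σ.obj k)} :
    P.HasBnf → (Tm.out m P).HasBnf
  | ⟨N, hN, h⟩ => ⟨.out m N, hN, .out m h⟩

theorem par {Γ Δ} {P Q : Tm σ Γ Δ .proc} : P.HasBnf → Q.HasBnf → (Tm.par P Q).HasBnf
  | ⟨N, hN, h⟩, ⟨M, hM, h'⟩ => ⟨.par N M, ⟨hN, hM⟩, .par h h'⟩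

theorem pabs {Γ Δ S} {P : Tm σ (S :: Γ) Δ .proc} : P.HasBnf → (Tm.pabs P).HasBnf
  | ⟨N, hN, h⟩ => ⟨.pabs N, hN, .pabs h⟩

theorem nabs {Γ Δ k} {P : Tm σ Γ (k :: Δ) .proc} : P.HasBnf → (Tm.nabs P).HasBnf
  | ⟨N, hN, h⟩ => ⟨.nabs N, hN, .nabs h⟩

end Tm.HasBnf

theorem Tm.BetaNormal.hasBnf_papp {Γ Δ S} {P : Tm σ Γ Δ (.pabs S)} {Q : Tm σ Γ Δ S}
    (hQ : Q.BetaNormal) (h : ∀ A, P = .pabs A → (A.psubst Q).HasBnf) : (Tm.papp P Q).HasBnf := by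
  cases P with
  | var y => exact ⟨.papp (.var y) Q, ⟨id, hQ⟩, .refl⟩
  | pabs A => exact (h A rfl).of_appSteps (.single (.here (.app1 A Q)))

theorem Tm.BetaNormal.hasBnf_napp {Γ Δ k} {P : Tm σ Γ Δ (.nabs k)} (hP : P.BetaNormal)
    (n : Name σ Δ k) : (Tm.napp P n).HasBnf := by
  cases P with
  | var y => exact ⟨.napp (.var y) n, id, .refl⟩
  | nabs A => exact ⟨A.nsubst n, Tm.BetaNormal.ren (P := A) hP _ _, .single (.here (.app2 A n))⟩

/-- The nesting depth of process abstractions in a type. -/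
def Ty.depth {K : Type u} : Ty K → ℕ
  | .proc => 0
  | .pabs S => S.depth + 1
  | .nabs _ => 0

/-- `θ` replaces every variable by a variable or by a β-normal term of a type of depth at most `n`.
The variables are there to keep the class closed under lifting below binders. -/
def PSub.DepthLE {Γ Γ' : List (Ty σ.NSort)} {Δ : List σ.NSort} (n : ℕ) (θ : PSub σ Γ Γ' Δ) : Prop :=
  ∀ ⦃T⦄ (x : Var Γ T), (∃ y, θ x = .var y) ∨ (θ x).BetaNormal ∧ T.depth ≤ n

theorem PSub.DepthLE.betaNormal {Γ Γ' : List (Ty σ.NSort)} {Δ : List σ.NSort} {n : ℕ}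
    {θ : PSub σ Γ Γ' Δ} (h : θ.DepthLE n) {T} (x : Var Γ T) : (θ x).BetaNormal := by
  rcases h x with ⟨y, hy⟩ | ⟨hx, _⟩
  · rw [hy]; trivial
  · exact hx

theorem PSub.DepthLE.liftP {Γ Γ' : List (Ty σ.NSort)} {Δ : List σ.NSort} {n : ℕ}
    {θ : PSub σ Γ Γ' Δ} (h : θ.DepthLE n) {S} : (PSub.liftP (S := S) θ).DepthLE n := by
  intro T x
  cases x with
  | z => exact .inl ⟨_, rfl⟩
  | s x =>
    rcases h x with ⟨y, hy⟩ | ⟨h₁, h₂⟩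
    · exact .inl ⟨.s y, by simp only [PSub.liftP, hy]; rfl⟩
    · exact .inr ⟨h₁.ren _ _, h₂⟩

theorem PSub.DepthLE.liftN {Γ Γ' : List (Ty σ.NSort)} {Δ : List σ.NSort} {n : ℕ}
    {θ : PSub σ Γ Γ' Δ} (h : θ.DepthLE n) {k} : (PSub.liftN (k := k) θ).DepthLE n := by
  intro T x
  rcases h x with ⟨y, hy⟩ | ⟨h₁, h₂⟩
  · exact .inl ⟨y, by simp only [PSub.liftN, hy]; rfl⟩
  · exact .inr ⟨h₁.ren _ _, h₂⟩

theorem PSub.DepthLE.single {Γ : List (Ty σ.NSort)} {Δ : List σ.NSort} {S} {Q : Tm σ Γ Δ S}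
    (hQ : Q.BetaNormal) : (PSub.single Q).DepthLE S.depth := by
  intro T x
  cases x with
  | z => exact .inr ⟨hQ, le_rfl⟩
  | s x => exact .inl ⟨x, rfl⟩

/-- Hereditary substitution: a redex created by substituting terms of depth at most `n` is an
abstraction over a variable of smaller depth. -/
theorem Tm.BetaNormal.hasBnf_sub (n : ℕ) {Γ Δ T} {P : Tm σ Γ Δ T} (hP : P.BetaNormal) {Γ'}
    {θ : PSub σ Γ Γ' Δ} (hθ : θ.DepthLE n) : (P.sub θ).HasBnf := by
  induction n using Nat.strong_induction_on generalizing Γ Δ T Γ' with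
  | _ n ihn =>
  induction P generalizing Γ' with
  | nil => exact ⟨.nil, trivial, .refl⟩
  | var x => exact ⟨θ x, hθ.betaNormal x, .refl⟩
  | inp m _ ih => exact .inp m (ih hP hθ.liftP)
  | out m _ ih => exact .out m (ih hP hθ)
  | par _ _ ih₁ ih₂ => exact .par (ih₁ hP.1 hθ) (ih₂ hP.2 hθ)
  | pabs _ ih => exact .pabs (ih hP hθ.liftP)
  | papp P Q _ ihQ =>
    obtain ⟨x, rfl⟩ := Tm.eq_var_of_not_isAbs_pabs hP.1
    obtain ⟨M, hM, hQM⟩ := ihQ hP.2 hθ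
    refine .of_appSteps (AppSteps.papp .refl hQM) (hM.hasBnf_papp fun A (hA : θ x = .pabs A) => ?_)
    rcases hθ x with ⟨y, hy⟩ | ⟨hx, hdepth⟩
    · cases hA.symm.trans hy
    · rw [hA] at hx
      exact ihn _ (Nat.lt_of_succ_le hdepth) (P := A) hx (PSub.DepthLE.single hM)
  | nabs _ ih => exact .nabs (ih hP hθ.liftN)
  | napp P m _ =>
    obtain ⟨x, rfl⟩ := Tm.eq_var_of_not_isAbs_nabs hP
    exact (hθ.betaNormal x).hasBnf_napp m

theorem Tm.hasBnf {Γ Δ T} (P : Tm σ Γ Δ T) : P.HasBnf := by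
  induction P with
  | nil => exact ⟨.nil, trivial, .refl⟩
  | var x => exact ⟨.var x, trivial, .refl⟩
  | inp m _ ih => exact .inp m ih
  | out m _ ih => exact .out m ih
  | par _ _ ih₁ ih₂ => exact .par ih₁ ih₂
  | pabs _ ih => exact .pabs ih
  | papp P Q ihP ihQ =>
    obtain ⟨N, hN, hPN⟩ := ihP
    obtain ⟨M, hM, hQM⟩ := ihQ
    refine .of_appSteps (AppSteps.papp hPN hQM) (hM.hasBnf_papp ?_)
    rintro A rfl
    exact Tm.BetaNormal.hasBnf_sub _ (P := A) hN (PSub.DepthLE.single hM)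
  | nabs _ ih => exact .nabs ih
  | napp P m ih =>
    obtain ⟨N, hN, hPN⟩ := ih
    exact .of_appSteps (AppSteps.napp m hPN) (hN.hasBnf_napp m)

/-- The β-normal form: the normal form of a term with respect to the application laws. -/
noncomputable def Tm.bnf {Γ Δ T} (P : Tm σ Γ Δ T) : Tm σ Γ Δ T :=
  P.hasBnf.choose

theorem Tm.betaNormal_bnf {Γ Δ T} (P : Tm σ Γ Δ T) : P.bnf.BetaNormal :=
  P.hasBnf.choose_spec.1

theorem Tm.appSteps_bnf {Γ Δ T} (P : Tm σ Γ Δ T) : AppSteps P P.bnf :=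
  P.hasBnf.choose_spec.2

theorem AppSteps.exists_dev_iterate {Γ Δ T} {P N : Tm σ Γ Δ T} (h : AppSteps P N)
    (hN : N.BetaNormal) : ∃ n₀, ∀ n ≥ n₀, Tm.dev^[n] P = N := by
  induction h using Relation.ReflTransGen.head_induction_on with
  | refl => exact ⟨0, fun n _ => hN.dev_iterate n⟩
  | @head P Q hPQ _ ih =>
    obtain ⟨n₀, h⟩ := ih
    refine ⟨n₀ + 1, fun n hn => ?_⟩
    obtain ⟨n, rfl⟩ : ∃ i, n = i + 1 := ⟨n - 1, by omega⟩
    have := (ParRed.compatible.of_inSubterm AppLaw.parRed hPQ).triangle.dev_iterate n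
    rw [h n (by omega)] at this
    exact hN.eq_of_parRed this

theorem AppSteps.bnf_eq {Γ Δ T} {P N : Tm σ Γ Δ T} (h : AppSteps P N) (hN : N.BetaNormal) :
    P.bnf = N := by
  obtain ⟨n, hn⟩ := h.exists_dev_iterate hN
  obtain ⟨m, hm⟩ := P.appSteps_bnf.exists_dev_iterate P.betaNormal_bnf
  rw [← hn (n + m) (by omega), hm (n + m) (by omega)]

theorem AppSteps.bnf_eq_bnf {Γ Δ T} {P Q : Tm σ Γ Δ T} (h : AppSteps P Q) : P.bnf = Q.bnf :=
  AppSteps.bnf_eq (h.trans Q.appSteps_bnf) Q.betaNormal_bnf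

theorem Tm.BetaNormal.bnf_eq {Γ Δ T} {P : Tm σ Γ Δ T} (h : P.BetaNormal) : P.bnf = P :=
  AppSteps.bnf_eq .refl h

theorem Tm.bnf_inp {Γ Δ} {k : σ.NSort} (m : Name σ Δ k) (P : Tm σ (σ.obj k :: Γ) Δ .proc) :
    (Tm.inp m P).bnf = .inp m P.bnf :=
  AppSteps.bnf_eq (AppSteps.inp m P.appSteps_bnf) P.betaNormal_bnf

theorem Tm.bnf_out {Γ Δ} {k : σ.NSort} (m : Name σ Δ k) (P : Tm σ Γ Δ (σ.obj k)) :
    (Tm.out m P).bnf = .out m P.bnf :=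
  AppSteps.bnf_eq (AppSteps.out m P.appSteps_bnf) P.betaNormal_bnf

theorem Tm.bnf_par {Γ Δ} (P Q : Tm σ Γ Δ .proc) : (Tm.par P Q).bnf = .par P.bnf Q.bnf :=
  AppSteps.bnf_eq (AppSteps.par P.appSteps_bnf Q.appSteps_bnf)
    ⟨P.betaNormal_bnf, Q.betaNormal_bnf⟩

theorem Tm.bnf_pabs {Γ Δ S} (P : Tm σ (S :: Γ) Δ .proc) : (Tm.pabs P).bnf = .pabs P.bnf :=
  AppSteps.bnf_eq (AppSteps.pabs P.appSteps_bnf) P.betaNormal_bnf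

theorem Tm.bnf_nabs {Γ Δ k} (P : Tm σ Γ (k :: Δ) .proc) : (Tm.nabs P).bnf = .nabs P.bnf :=
  AppSteps.bnf_eq (AppSteps.nabs P.appSteps_bnf) P.betaNormal_bnf

theorem Tm.bnf_papp_var {Γ Δ S} (x : Var Γ (.pabs S)) (P : Tm σ Γ Δ S) :
    (Tm.papp (.var x) P).bnf = .papp (.var x) P.bnf :=
  AppSteps.bnf_eq (AppSteps.papp .refl P.appSteps_bnf) ⟨id, P.betaNormal_bnf⟩

theorem Cong.bnf {B : TRel σ} (hB : Stable B) {Γ Δ T} {P Q : Tm σ Γ Δ T} (h : Cong B P Q) :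
    Cong B P.bnf Q.bnf := by
  obtain ⟨n, hn⟩ := P.appSteps_bnf.exists_dev_iterate P.betaNormal_bnf
  obtain ⟨m, hm⟩ := Q.appSteps_bnf.exists_dev_iterate Q.betaNormal_bnf
  rw [← hn (n + m) (by omega), ← hm (n + m) (by omega)]
  generalize n + m = i
  clear hn hm
  induction i generalizing P Q with
  | zero => exact h
  | succ _ ih => exact ih (h.dev hB)

theorem Cong.bnf_of_or_appLaw {B : TRel σ} (hB : Stable B) {Γ Δ T} {P Q : Tm σ Γ Δ T}
    (h : Cong (fun _ _ _ P Q => B P Q ∨ AppLaw P Q) P Q) : Cong B P.bnf Q.bnf := by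
  induction h with
  | base h =>
    rcases h with h | h
    · exact (Cong.base h).bnf hB
    · rw [AppSteps.bnf_eq_bnf (.single (.here h))]
      exact .refl _
  | refl P => exact .refl _
  | symm _ ih => exact ih.symm
  | trans _ _ ih₁ ih₂ => exact ih₁.trans ih₂
  | inp m _ ih => rw [Tm.bnf_inp, Tm.bnf_inp]; exact ih.inp m
  | out m _ ih => rw [Tm.bnf_out, Tm.bnf_out]; exact ih.out m
  | par _ _ ih₁ ih₂ => rw [Tm.bnf_par, Tm.bnf_par]; exact ih₁.par ih₂
  | pabs _ ih => rw [Tm.bnf_pabs, Tm.bnf_pabs]; exact ih.pabs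
  | @papp _ _ _ P P' Q Q' _ _ ih₁ ih₂ =>
    rw [AppSteps.bnf_eq_bnf (AppSteps.papp P.appSteps_bnf Q.appSteps_bnf),
      AppSteps.bnf_eq_bnf (AppSteps.papp P'.appSteps_bnf Q'.appSteps_bnf)]
    exact (ih₁.papp ih₂).bnf hB
  | nabs _ ih => rw [Tm.bnf_nabs, Tm.bnf_nabs]; exact ih.nabs
  | @napp _ _ _ P P' n _ ih =>
    rw [AppSteps.bnf_eq_bnf (AppSteps.napp n P.appSteps_bnf),
      AppSteps.bnf_eq_bnf (AppSteps.napp n P'.appSteps_bnf)]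
    exact (ih.napp n).bnf hB

theorem SCongr.mCongr_bnf {Γ Δ T} {P Q : Tm σ Γ Δ T} (h : SCongr P Q) : MCongr P.bnf Q.bnf :=
  Cong.bnf_of_or_appLaw stable_monoidLaw h

theorem AxEq.bnf {Γ Δ T} {P Q : Tm σ Γ Δ T} (h : AxEq P Q) : Cong MonoidDisLaw P.bnf Q.bnf :=
  Cong.bnf_of_or_appLaw stable_monoidDisLaw (Cong.mono or_assoc.2 h)

theorem MCongr.sCongr {Γ Δ T} {P Q : Tm σ Γ Δ T} (h : MCongr P Q) : SCongr P Q :=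
  Cong.mono Or.inl h

theorem SCongr.axEq {Γ Δ T} {P Q : Tm σ Γ Δ T} (h : SCongr P Q) : AxEq P Q :=
  Cong.mono (Or.imp_right Or.inr) h

theorem axEq_of_monoidDisLaw {Γ Δ T} {P Q : Tm σ Γ Δ T} (h : Cong MonoidDisLaw P Q) : AxEq P Q :=
  Cong.mono (Or.imp_right Or.inl) h

theorem AppSteps.sCongr {Γ Δ T} {P Q : Tm σ Γ Δ T} (h : AppSteps P Q) : SCongr P Q := by
  induction h with
  | refl => exact .refl _
  | tail _ h ih => exact ih.trans ((Cong.compatible _).of_inSubterm (fun h => .base (.inr h)) h)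

theorem Tm.sCongr_bnf {Γ Δ T} (P : Tm σ Γ Δ T) : SCongr P P.bnf :=
  P.appSteps_bnf.sCongr

end BetaNormal

section Factors

variable {σ : Sorting.{u}}

/-- The process is neither `0` nor a parallel composition. -/
def Tm.IsPrime {Γ : List (Ty σ.NSort)} {Δ : List σ.NSort} : Tm σ Γ Δ .proc → Prop
  | .nil => False
  | .par _ _ => False
  | _ => True

/-- `Factor P F R`: the process `P` is a parallel composition with a prime component `F`, and `R` is
obtained from `P` by replacing this component by `0`. -/
inductive Factor {Γ : List (Ty σ.NSort)} {Δ : List σ.NSort} :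
    ∀ {T : Ty σ.NSort}, Tm σ Γ Δ T → Tm σ Γ Δ .proc → Tm σ Γ Δ .proc → Prop
  | here {F : Tm σ Γ Δ .proc} : F.IsPrime → Factor F F .nil
  | parL {P F R : Tm σ Γ Δ .proc} (Q : Tm σ Γ Δ .proc) :
      Factor P F R → Factor (.par P Q) F (.par R Q)
  | parR {Q F R : Tm σ Γ Δ .proc} (P : Tm σ Γ Δ .proc) :
      Factor Q F R → Factor (.par P Q) F (.par P R)

/-- `FactorMatch S F R F' R'`: the prime processes `F` and `F'` have the same form, and, up to `S`,
their components are related and so are the remaining processes `R` and `R'`. For inputs, the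
processes reached by the input are related. -/
inductive FactorMatch (S : TRel σ) {Γ : List (Ty σ.NSort)} {Δ : List σ.NSort} :
    Tm σ Γ Δ .proc → Tm σ Γ Δ .proc → Tm σ Γ Δ .proc → Tm σ Γ Δ .proc → Prop
  | inp {k : σ.NSort} (m : Name σ Δ k) {A B R R'} :
      S (.par A R.wkP) (.par B R'.wkP) → FactorMatch S (.inp m A) R (.inp m B) R'
  | out {k : σ.NSort} (m : Name σ Δ k) {A B R R'} :
      S A B → S R R' → FactorMatch S (.out m A) R (.out m B) R'
  | var (X : Var Γ .proc) {R R'} : S R R' → FactorMatch S (.var X) R (.var X) R'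
  | papp {T} {P P' : Tm σ Γ Δ (.pabs T)} {A B R R'} :
      S P P' → S A B → S R R' → FactorMatch S (.papp P A) R (.papp P' B) R'
  | napp {k} {P P' : Tm σ Γ Δ (.nabs k)} (n : Name σ Δ k) {R R'} :
      S P P' → S R R' → FactorMatch S (.napp P n) R (.napp P' n) R'

/-- Every prime factor of `P` is matched by a prime factor of `Q`. -/
def FactorSim (S : TRel σ) {Γ Δ T} (P Q : Tm σ Γ Δ T) : Prop :=
  ∀ ⦃F R⦄, Factor P F R → ∃ F' R', Factor Q F' R' ∧ FactorMatch S F R F' R'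

/-- `P` and `Q` have matching prime factors. -/
def FactorBisim (S : TRel σ) {Γ Δ T} (P Q : Tm σ Γ Δ T) : Prop :=
  FactorSim S P Q ∧ FactorSim S Q P

theorem Factor.isPrime {Γ Δ T} {P : Tm σ Γ Δ T} {F R : Tm σ Γ Δ .proc} (h : Factor P F R) :
    F.IsPrime := by
  induction h with
  | here h => exact h
  | parL _ _ ih => exact ih
  | parR _ _ ih => exact ih

theorem FactorMatch.trans {S : TRel σ}
    (hS : ∀ {Γ Δ T} {P Q R : Tm σ Γ Δ T}, S P Q → S Q R → S P R) {Γ Δ}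
    {F₁ R₁ F₂ R₂ F₃ R₃ : Tm σ Γ Δ .proc} (h : FactorMatch S F₁ R₁ F₂ R₂)
    (h' : FactorMatch S F₂ R₂ F₃ R₃) : FactorMatch S F₁ R₁ F₃ R₃ := by
  cases h with
  | inp m h => cases h' with | inp _ h' => exact .inp m (hS h h')
  | out m h₁ h₂ => cases h' with | out _ h₁' h₂' => exact .out m (hS h₁ h₁') (hS h₂ h₂')
  | var X h => cases h' with | var _ h' => exact .var X (hS h h')
  | papp h₁ h₂ h₃ =>
    cases h' with | papp h₁' h₂' h₃' => exact .papp (hS h₁ h₁') (hS h₂ h₂') (hS h₃ h₃')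
  | napp n h₁ h₂ => cases h' with | napp _ h₁' h₂' => exact .napp n (hS h₁ h₁') (hS h₂ h₂')

theorem FactorSim.trans {S : TRel σ}
    (hS : ∀ {Γ Δ T} {P Q R : Tm σ Γ Δ T}, S P Q → S Q R → S P R) {Γ Δ T}
    {P Q R : Tm σ Γ Δ T} (h : FactorSim S P Q) (h' : FactorSim S Q R) : FactorSim S P R := by
  intro F E hF
  obtain ⟨F', E', hF', hm⟩ := h hF
  obtain ⟨F'', E'', hF'', hm'⟩ := h' hF'
  exact ⟨F'', E'', hF'', FactorMatch.trans (S := S) hS hm hm'⟩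

theorem FactorMatch.mono {S S' : TRel σ} (hS : ∀ {Γ Δ T} {P Q : Tm σ Γ Δ T}, S P Q → S' P Q)
    {Γ Δ} {F R F' R' : Tm σ Γ Δ .proc} (h : FactorMatch S F R F' R') :
    FactorMatch S' F R F' R' := by
  cases h with
  | inp m h => exact .inp m (hS h)
  | out m h₁ h₂ => exact .out m (hS h₁) (hS h₂)
  | var X h => exact .var X (hS h)
  | papp h₁ h₂ h₃ => exact .papp (hS h₁) (hS h₂) (hS h₃)
  | napp n h₁ h₂ => exact .napp n (hS h₁) (hS h₂)

theorem FactorMatch.factorSim {S : TRel σ} {Γ Δ} {P Q : Tm σ Γ Δ .proc}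
    (h : FactorMatch S P .nil Q .nil) : FactorSim S P Q := by
  intro F R hF
  have hPQ := h
  cases h <;> cases hF <;> exact ⟨_, _, .here trivial, hPQ⟩

theorem Factor.copies {Γ Δ} {n : ℕ} {P F R : Tm σ Γ Δ .proc} (hP : P.IsPrime)
    (h : Factor (Tm.copies n P) F R) : F = P ∧ ∃ i, n = i + 1 ∧ MCongr R (Tm.copies i P) := by
  induction n generalizing R with
  | zero => cases h with | here h => exact h.elim
  | succ n ih =>
    cases h with
    | here h => exact h.elim
    | parL _ h =>
      cases h with
      | here => exact ⟨rfl, n, rfl, .trans (.base (.comm _ _)) (.base (.unit _))⟩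
      | parL => exact hP.elim
      | parR => exact hP.elim
    | parR _ h =>
      obtain ⟨rfl, i, rfl, h'⟩ := ih h
      exact ⟨rfl, i + 1, rfl, .par (.refl _) h'⟩

section

variable {B : TRel σ} (hB : Stable B)
include hB

theorem FactorMatch.of_rest {Γ Δ} {F R R' : Tm σ Γ Δ .proc} (hF : F.IsPrime)
    (h : Cong B R R') : FactorMatch (Cong B) F R F R' := by
  cases F with
  | nil => exact hF.elim
  | par => exact hF.elim
  | var x => exact .var x h
  | inp m A => exact .inp m ((Cong.refl _).par (h.wkP hB))
  | out m A => exact .out m (.refl _) h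
  | papp P A => exact .papp (.refl _) (.refl _) h
  | napp P n => exact .napp n (.refl _) h

theorem FactorMatch.rest_trans {Γ Δ} {F R F' R' R₁ R₁' : Tm σ Γ Δ .proc}
    (h₁ : Cong B R₁ R) (hF : FactorMatch (Cong B) F R F' R') (h : Cong B R' R₁')
    (hp : F.IsPrime) (hp' : F'.IsPrime) : FactorMatch (Cong B) F R₁ F' R₁' :=
  ((FactorMatch.of_rest hB hp h₁).trans Cong.trans hF).trans Cong.trans
    (FactorMatch.of_rest hB hp' h)

theorem FactorSim.of_rest {Γ Δ T} {P Q : Tm σ Γ Δ T}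
    (h : ∀ ⦃F R⦄, Factor P F R → ∃ R', Factor Q F R' ∧ Cong B R R') :
    FactorSim (Cong B) P Q := by
  intro F R hF
  obtain ⟨R', h₁, h₂⟩ := h hF
  exact ⟨F, R', h₁, .of_rest hB hF.isPrime h₂⟩

variable (hM : ∀ {Γ Δ T} {P Q : Tm σ Γ Δ T}, MonoidLaw P Q → B P Q)
include hM

theorem FactorMatch.par {Γ Δ} {F R F' R' Q Q' : Tm σ Γ Δ .proc}
    (hF : FactorMatch (Cong B) F R F' R') (h : Cong B Q Q') :
    FactorMatch (Cong B) F (.par R Q) F' (.par R' Q') := by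
  cases hF with
  | inp m hA =>
    exact .inp m (.trans (.symm (.base (hM (.assoc _ _ _))))
      ((hA.par (h.wkP hB)).trans (.base (hM (.assoc _ _ _)))))
  | out m h₁ h₂ => exact .out m h₁ (h₂.par h)
  | var X h₁ => exact .var X (h₁.par h)
  | papp h₁ h₂ h₃ => exact .papp h₁ h₂ (h₃.par h)
  | napp n h₁ h₂ => exact .napp n h₁ (h₂.par h)

theorem MonoidLaw.factorSim {Γ Δ T} {P Q : Tm σ Γ Δ T} (h : MonoidLaw P Q) :
    FactorSim (Cong B) P Q := by
  have hb : ∀ {Γ Δ T} {P Q : Tm σ Γ Δ T}, MonoidLaw P Q → Cong B P Q := fun h => .base (hM h)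
  refine FactorSim.of_rest hB fun F R hF => ?_
  cases h with
  | assoc P Q R =>
    cases hF with
    | here h => exact h.elim
    | parL _ h =>
      cases h with
      | here h => exact h.elim
      | parL _ h => exact ⟨_, .parL _ h, hb (.assoc _ _ _)⟩
      | parR _ h => exact ⟨_, .parR _ (.parL _ h), hb (.assoc _ _ _)⟩
    | parR _ h => exact ⟨_, .parR _ (.parR _ h), hb (.assoc _ _ _)⟩
  | comm P Q =>
    cases hF with
    | here h => exact h.elim
    | parL _ h => exact ⟨_, .parR _ h, hb (.comm _ _)⟩
    | parR _ h => exact ⟨_, .parL _ h, hb (.comm _ _)⟩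
  | unit P =>
    cases hF with
    | here h => exact h.elim
    | parL _ h => exact ⟨_, h, hb (.unit _)⟩
    | parR _ h => cases h with | here h => exact h.elim

theorem MonoidLaw.factorSim_symm {Γ Δ T} {P Q : Tm σ Γ Δ T} (h : MonoidLaw P Q) :
    FactorSim (Cong B) Q P := by
  have hb : ∀ {Γ Δ T} {P Q : Tm σ Γ Δ T}, MonoidLaw P Q → Cong B Q P :=
    fun h => .symm (.base (hM h))
  cases h with
  | assoc P Q R =>
    refine FactorSim.of_rest hB fun F R hF => ?_
    cases hF with
    | here h => exact h.elim
    | parL _ h => exact ⟨_, .parL _ (.parL _ h), hb (.assoc _ _ _)⟩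
    | parR _ h =>
      cases h with
      | here h => exact h.elim
      | parL _ h => exact ⟨_, .parL _ (.parR _ h), hb (.assoc _ _ _)⟩
      | parR _ h => exact ⟨_, .parR _ h, hb (.assoc _ _ _)⟩
  | comm P Q => exact MonoidLaw.factorSim hB hM (.comm Q P)
  | unit P => exact FactorSim.of_rest hB fun F R hF => ⟨_, .parL _ hF, hb (.unit _)⟩

theorem FactorSim.par {Γ Δ} {P P' Q Q' : Tm σ Γ Δ .proc} (hP : Cong B P P') (hQ : Cong B Q Q')
    (h₁ : FactorSim (Cong B) P P') (h₂ : FactorSim (Cong B) Q Q') :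
    FactorSim (Cong B) (.par P Q) (.par P' Q') := by
  intro F R hF
  cases hF with
  | here h => exact h.elim
  | parL _ h =>
    obtain ⟨F', R', h', hm⟩ := h₁ h
    exact ⟨F', _, .parL _ h', hm.par hB hM hQ⟩
  | parR _ h =>
    obtain ⟨F', R', h', hm⟩ := h₂ h
    have hc : ∀ {P Q : Tm σ Γ Δ .proc}, Cong B (.par P Q) (.par Q P) := .base (hM (.comm _ _))
    exact ⟨F', _, .parR _ h', .rest_trans hB hc (hm.par hB hM hP) hc h.isPrime h'.isPrime⟩

theorem Cong.factorBisim
    (hF : ∀ {Γ Δ T} {P Q : Tm σ Γ Δ T}, B P Q → FactorBisim (Cong B) P Q)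
    {Γ Δ T} {P Q : Tm σ Γ Δ T} (h : Cong B P Q) : FactorBisim (Cong B) P Q := by
  have hnil : ∀ {Γ Δ} {P Q : Tm σ Γ Δ .proc}, Cong B P Q → Cong B (.par P .nil) (.par Q .nil) :=
    fun h => h.par (.refl _)
  induction h with
  | base h => exact hF h
  | refl P =>
    have : FactorSim (Cong B) P P := .of_rest hB fun F R h => ⟨R, h, .refl _⟩
    exact ⟨this, this⟩
  | symm _ ih => exact ih.symm
  | trans _ _ ih₁ ih₂ => exact ⟨ih₁.1.trans Cong.trans ih₂.1, ih₂.2.trans Cong.trans ih₁.2⟩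
  | inp m h =>
    exact ⟨FactorMatch.factorSim (.inp m (hnil h)), FactorMatch.factorSim (.inp m (hnil h.symm))⟩
  | out m h =>
    exact ⟨FactorMatch.factorSim (.out m h (.refl _)),
      FactorMatch.factorSim (.out m h.symm (.refl _))⟩
  | par h₁ h₂ ih₁ ih₂ =>
    exact ⟨.par hB hM h₁ h₂ ih₁.1 ih₂.1, .par hB hM h₁.symm h₂.symm ih₁.2 ih₂.2⟩
  | papp h₁ h₂ =>
    exact ⟨FactorMatch.factorSim (.papp h₁ h₂ (.refl _)),
      FactorMatch.factorSim (.papp h₁.symm h₂.symm (.refl _))⟩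
  | napp n h =>
    exact ⟨FactorMatch.factorSim (.napp n h (.refl _)),
      FactorMatch.factorSim (.napp n h.symm (.refl _))⟩
  | pabs | nabs => constructor <;> intro F R hF <;> cases hF

end

theorem MCongr.factorSim {Γ Δ T} {P Q : Tm σ Γ Δ T} (h : MCongr P Q) : FactorSim MCongr P Q :=
  (Cong.factorBisim stable_monoidLaw id (fun h =>
    ⟨h.factorSim stable_monoidLaw id, h.factorSim_symm stable_monoidLaw id⟩) h).1

theorem Tm.wkP_copies {Γ Δ S} (n : ℕ) (P : Tm σ Γ Δ .proc) :
    (Tm.copies n P).wkP (S := S) = Tm.copies n P.wkP := by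
  simp only [Tm.wkP, Tm.ren_eq_msub, Tm.msub_copies]

theorem Factor.copies_succ {Γ Δ} (n : ℕ) {P : Tm σ Γ Δ .proc} (hP : P.IsPrime) :
    Factor (Tm.copies (n + 1) P) P (.par .nil (Tm.copies n P)) :=
  .parL _ (.here hP)

theorem DisLaw.factorBisim {Γ Δ T} {P Q : Tm σ Γ Δ T} (h : DisLaw P Q) :
    FactorBisim (Cong MonoidDisLaw) P Q := by
  obtain ⟨m, P, k, hk⟩ := h
  obtain ⟨i, rfl⟩ : ∃ i, k = i + 1 := ⟨k - 1, by omega⟩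
  have hM : ∀ {Γ Δ T} {P Q : Tm σ Γ Δ T}, MCongr P Q → Cong MonoidDisLaw P Q := Cong.mono Or.inl
  have residual : ∀ {R}, MCongr R (Tm.copies i (.inp m P)) →
      MCongr (.par (.par P (Tm.copies i (Tm.inp m P).wkP)) (Tm.wkP .nil)) (.par P R.wkP) := by
    intro R hR
    refine (Cong.base (.unit _)).trans (.par (.refl _) ?_)
    rw [← Tm.wkP_copies]
    exact (hR.wkP stable_monoidLaw).symm
  constructor
  · intro F R hF
    cases hF
    exact ⟨_, _, .copies_succ i trivial,
      .inp m (hM (residual (.trans (.base (.comm _ _)) (.base (.unit _)))))⟩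
  · intro F R hF
    obtain ⟨rfl, j, hj, h⟩ := Factor.copies (P := .inp m P) trivial hF
    obtain rfl : i = j := by omega
    exact ⟨_, _, .here trivial, .inp m (hM (residual h).symm)⟩

theorem factorSim_of_monoidDisLaw {Γ Δ T} {P Q : Tm σ Γ Δ T} (h : Cong MonoidDisLaw P Q) :
    FactorSim (Cong MonoidDisLaw) P Q :=
  (Cong.factorBisim stable_monoidDisLaw Or.inl (fun h => h.elim
    (fun h => ⟨h.factorSim stable_monoidDisLaw Or.inl, h.factorSim_symm stable_monoidDisLaw Or.inl⟩)
    DisLaw.factorBisim) h).1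

end Factors

section Transitions

variable {σ : Sorting.{u}}

theorem Factor.mCongr {Γ Δ} {P F R : Tm σ Γ Δ .proc} : Factor P F R → MCongr P (.par F R)
  | .here _ => .symm (.base (.unit _))
  | .parL _ h => (h.mCongr.par (.refl _)).trans (.base (.assoc _ _ _))
  | .parR _ h => (Cong.base (.comm _ _)).trans ((h.mCongr.par (.refl _)).trans
      ((Cong.base (.assoc _ _ _)).trans (.par (.refl _) (.base (.comm _ _)))))

theorem Factor.sCongr {Γ Δ} {P F R : Tm σ Γ Δ .proc} (h : Factor P.bnf F R) :
    SCongr P (.par F R) :=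
  P.sCongr_bnf.trans h.mCongr.sCongr

theorem AppLaw.msub {Γ Δ T} {P Q : Tm σ Γ Δ T} (h : AppLaw P Q) {Γ' Δ'} (θ : PSub σ Γ Γ' Δ')
    (ν : NSub σ Δ Δ') : AppLaw (P.msub θ ν) (Q.msub θ ν) := by
  cases h with
  | app1 P Q => rw [Tm.msub_psubst]; exact .app1 _ _
  | app2 P m => rw [Tm.msub_nsubst]; exact .app2 _ _

theorem SCongr.wkP {Γ Δ T S} {P Q : Tm σ Γ Δ T} (h : SCongr P Q) :
    SCongr (P.wkP (S := S)) Q.wkP := by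
  simp only [Tm.wkP, Tm.ren_eq_msub]
  exact Cong.msub (fun h _ _ θ ν =>
    h.imp (fun h => stable_monoidLaw.msub h θ ν) (fun h => h.msub θ ν)) h _ _

theorem Factor.outTr {Γ Δ} {P R : Tm σ Γ Δ .proc} {k} {m : Name σ Δ k} {A : Tm σ Γ Δ (σ.obj k)}
    (h : Factor P (.out m A) R) : OutTr m A P R :=
  .struct h.mCongr.sCongr (.parL R .out) (.trans (.base (.inl (.comm _ _)))
    (.base (.inl (.unit _))))

theorem Factor.inpTr {Γ Δ} {P R : Tm σ Γ Δ .proc} {k} {m : Name σ Δ k}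
    {A : Tm σ (σ.obj k :: Γ) Δ .proc} (h : Factor P (.inp m A) R) : InpTr m P (.par A R.wkP) :=
  .struct h.mCongr.sCongr (.parL R (.inp A)) (.refl _)

theorem OutTr.exists_factor {Γ Δ} {P P' : Tm σ Γ Δ .proc} {k} {m : Name σ Δ k}
    {A : Tm σ Γ Δ (σ.obj k)} (h : OutTr m A P P') :
    ∃ A' R, Factor P.bnf (.out m A') R ∧ SCongr A A' ∧ SCongr P' R := by
  induction h with
  | out => rw [Tm.bnf_out]; exact ⟨A.bnf, .nil, .here trivial, A.sCongr_bnf, .refl _⟩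
  | parL Q _ ih =>
    obtain ⟨A', R, h₁, h₂, h₃⟩ := ih
    rw [Tm.bnf_par]
    exact ⟨A', _, .parL _ h₁, h₂, h₃.par Q.sCongr_bnf⟩
  | parR P _ ih =>
    obtain ⟨A', R, h₁, h₂, h₃⟩ := ih
    rw [Tm.bnf_par]
    exact ⟨A', _, .parR _ h₁, h₂, P.sCongr_bnf.par h₃⟩
  | struct h _ h' ih =>
    obtain ⟨A', R, h₁, h₂, h₃⟩ := ih
    obtain ⟨F', R', hF, hm⟩ := MCongr.factorSim (Cong.symm h.mCongr_bnf) h₁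
    cases hm with
    | out _ h₄ h₅ =>
      exact ⟨_, _, hF, h₂.trans h₄.sCongr, h'.symm.trans (h₃.trans h₅.sCongr)⟩

theorem InpTr.exists_factor {Γ Δ} {P : Tm σ Γ Δ .proc} {k} {m : Name σ Δ k}
    {P' : Tm σ (σ.obj k :: Γ) Δ .proc} (h : InpTr m P P') :
    ∃ A R, Factor P.bnf (.inp m A) R ∧ SCongr P' (.par A R.wkP) := by
  induction h with
  | inp P =>
    rw [Tm.bnf_inp]
    exact ⟨P.bnf, .nil, .here trivial,
      P.sCongr_bnf.trans (.symm (.base (.inl (.unit _))))⟩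
  | parL Q _ ih =>
    obtain ⟨A, R, h₁, h₂⟩ := ih
    rw [Tm.bnf_par]
    exact ⟨A, _, .parL _ h₁,
      (h₂.par Q.sCongr_bnf.wkP).trans (.base (.inl (.assoc _ _ _)))⟩
  | parR P _ ih =>
    obtain ⟨A, R, h₁, h₂⟩ := ih
    rw [Tm.bnf_par]
    exact ⟨A, _, .parR _ h₁,
      (P.sCongr_bnf.wkP.par h₂).trans ((Cong.base (.inl (.comm _ _))).trans
        ((Cong.base (.inl (.assoc _ _ _))).trans (.par (.refl _) (.base (.inl (.comm _ _))))))⟩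
  | struct h _ h' ih =>
    obtain ⟨A, R, h₁, h₂⟩ := ih
    obtain ⟨F', R', hF, hm⟩ := MCongr.factorSim (Cong.symm h.mCongr_bnf) h₁
    cases hm with
    | inp _ h₄ => exact ⟨_, _, hF, h'.symm.trans (h₂.trans h₄.sCongr)⟩

theorem SCongr.exists_factor {Γ Δ} {P F N P' : Tm σ Γ Δ .proc} (h : SCongr P (.par F P'))
    (hF : F.bnf = N) (hN : N.IsPrime) :
    ∃ F' R, Factor P.bnf F' R ∧ FactorMatch MCongr N P'.bnf F' R := by
  have h' := h.mCongr_bnf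
  rw [Tm.bnf_par, hF] at h'
  obtain ⟨F', R, h₁, h₂⟩ := MCongr.factorSim h'.symm (.parL _ (.here hN))
  exact ⟨F', R, h₁, .rest_trans stable_monoidLaw
    (.trans (.symm (.base (.unit _))) (.base (.comm _ _))) h₂ (.refl _) hN h₁.isPrime⟩

theorem SCongr.headMatch {Γ Δ T} {P Q : Tm σ Γ Δ T} (h : SCongr P Q) : HeadMatch SCongr P Q :=
  Cong.headMatch (fun h => by rcases h with h | h <;> cases h <;> rfl) h

theorem AxEq.headMatch {Γ Δ T} {P Q : Tm σ Γ Δ T} (h : AxEq P Q) : HeadMatch AxEq P Q :=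
  Cong.headMatch (fun h => by rcases h with h | h | h <;> cases h <;> rfl) h

theorem Tm.not_isAbs_proc {Γ Δ} (P : Tm σ Γ Δ .proc) : ¬ P.IsAbs := by
  cases P <;> exact id

theorem AxEq.factor {Γ Δ} {P Q F R : Tm σ Γ Δ .proc} (h : AxEq P Q) (hF : Factor P.bnf F R) :
    ∃ F' R', Factor Q.bnf F' R' ∧ FactorMatch AxEq F R F' R' := by
  obtain ⟨F', R', h₁, h₂⟩ := factorSim_of_monoidDisLaw h.bnf hF
  exact ⟨F', R', h₁, h₂.mono axEq_of_monoidDisLaw⟩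

theorem AxEq.factor_of_sCongr {Γ Δ} {P Q F N P' : Tm σ Γ Δ .proc} (h : AxEq P Q)
    (hP : SCongr P (.par F P')) (hF : F.bnf = N) (hN : N.IsPrime) :
    ∃ F' R', SCongr Q (.par F' R') ∧ FactorMatch AxEq N P'.bnf F' R' := by
  obtain ⟨F', R', h₁, h₂⟩ := hP.exists_factor hF hN
  obtain ⟨F'', R'', h₃, h₄⟩ := h.factor h₁
  exact ⟨F'', R'', h₃.sCongr, (h₂.mono fun h => h.sCongr.axEq).trans Cong.trans h₄⟩

theorem AxEq.exists_outTr {Γ Δ} {P Q P' : Tm σ Γ Δ .proc} (h : AxEq P Q) {k} {m : Name σ Δ k}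
    {A : Tm σ Γ Δ (σ.obj k)} (hP : OutTr m A P P') :
    ∃ B Q', OutTr m B Q Q' ∧ AxEq A B ∧ AxEq P' Q' := by
  obtain ⟨A', R, h₁, hA, hP'⟩ := hP.exists_factor
  obtain ⟨F, R', h₂, hm⟩ := h.factor h₁
  cases hm with
  | out _ hB hR =>
    exact ⟨_, R', .struct Q.sCongr_bnf h₂.outTr (.refl _), hA.axEq.trans hB, hP'.axEq.trans hR⟩

theorem AxEq.exists_inpTr {Γ Δ} {P Q : Tm σ Γ Δ .proc} (h : AxEq P Q) {k} {m : Name σ Δ k}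
    {P' : Tm σ (σ.obj k :: Γ) Δ .proc} (hP : InpTr m P P') :
    ∃ Q', InpTr m Q Q' ∧ AxEq P' Q' := by
  obtain ⟨A, R, h₁, hP'⟩ := hP.exists_factor
  obtain ⟨F, R', h₂, hm⟩ := h.factor h₁
  cases hm with
  | inp _ hA => exact ⟨_, .struct Q.sCongr_bnf h₂.inpTr (.refl _), hP'.axEq.trans hA⟩

theorem isHOIOBisim_axEq : IsHOIOBisim (AxEq (σ := σ)) where
  symm h := Cong.symm h
  nonabs h hP := by
    cases h.headMatch with
    | proc => exact Tm.not_isAbs_proc _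
    | var => exact id
    | pabs => exact hP
    | nabs => exact hP
  pabs h := by cases h.headMatch with | pabs h' => exact ⟨_, rfl, h'⟩
  nabs h := by cases h.headMatch with | nabs h' => exact ⟨_, rfl, h'⟩
  out h _ _ _ _ hP := AxEq.exists_outTr h hP
  inp h _ _ _ hP := AxEq.exists_inpTr h hP
  var h X P' hP := by
    obtain ⟨F, R, h₁, hm⟩ :=
      AxEq.factor_of_sCongr h hP (Tm.BetaNormal.bnf_eq (P := .var X) trivial) trivial
    cases hm with
    | var _ hR => exact ⟨R, h₁, P'.sCongr_bnf.axEq.trans hR⟩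
  varAbs X Q hT h := by
    cases h.headMatch with
    | proc => exact (hT rfl).elim
    | var => exact .refl _
  varPapp h S X A P' hP := by
    obtain ⟨F, R, h₁, hm⟩ := AxEq.factor_of_sCongr h hP (Tm.bnf_papp_var X A) trivial
    cases hm with
    | papp hX hA hR =>
      cases hX.headMatch
      exact ⟨_, R, h₁, A.sCongr_bnf.axEq.trans hA, P'.sCongr_bnf.axEq.trans hR⟩
  varNapp h k X n P' hP := by
    obtain ⟨F, R, h₁, hm⟩ :=
      AxEq.factor_of_sCongr h hP (Tm.BetaNormal.bnf_eq (P := .napp (.var X) n) id) trivial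
    cases hm with
    | napp _ hX hR =>
      cases hX.headMatch
      exact ⟨R, h₁, P'.sCongr_bnf.axEq.trans hR⟩

theorem AxEq.bisim {Γ Δ T} {P Q : Tm σ Γ Δ T} (h : AxEq P Q) : Bisim P Q :=
  ⟨AxEq, isHOIOBisim_axEq, h⟩

theorem isHOIOBisim_bisim : IsHOIOBisim (Bisim (σ := σ)) where
  symm := fun ⟨R, hR, h⟩ => ⟨R, hR, hR.symm h⟩
  nonabs := fun ⟨_, hR, h⟩ => hR.nonabs h
  pabs := fun ⟨R, hR, h⟩ => (hR.pabs h).imp fun _ h => ⟨h.1, R, hR, h.2⟩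
  nabs := fun ⟨R, hR, h⟩ => (hR.nabs h).imp fun _ h => ⟨h.1, R, hR, h.2⟩
  out := fun ⟨R, hR, h⟩ _ m A P' hP =>
    (hR.out h m A P' hP).imp fun _ h => h.imp fun _ h => ⟨h.1, ⟨R, hR, h.2.1⟩, R, hR, h.2.2⟩
  inp := fun ⟨R, hR, h⟩ _ m P' hP => (hR.inp h m P' hP).imp fun _ h => ⟨h.1, R, hR, h.2⟩
  var := fun ⟨R, hR, h⟩ X P' hP => (hR.var h X P' hP).imp fun _ h => ⟨h.1, R, hR, h.2⟩
  varAbs := fun X _ hT ⟨_, hR, h⟩ => hR.varAbs X hT h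
  varPapp := fun ⟨R, hR, h⟩ _ X A P' hP =>
    (hR.varPapp h X A P' hP).imp fun _ h => h.imp fun _ h => ⟨h.1, ⟨R, hR, h.2.1⟩, R, hR, h.2.2⟩
  varNapp := fun ⟨R, hR, h⟩ _ X n P' hP =>
    (hR.varNapp h X n P' hP).imp fun _ h => ⟨h.1, R, hR, h.2⟩

theorem Bisim.symm {Γ Δ T} {P Q : Tm σ Γ Δ T} (h : Bisim P Q) : Bisim Q P :=
  isHOIOBisim_bisim.symm h

theorem IsHOIOBisim.comp {S : TRel σ} (hS : IsHOIOBisim S) :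
    IsHOIOBisim fun _ _ _ P R => ∃ Q, S P Q ∧ S Q R where
  symm := fun ⟨Q, h, h'⟩ => ⟨Q, hS.symm h', hS.symm h⟩
  nonabs := fun ⟨_, h, h'⟩ hP => hS.nonabs h' (hS.nonabs h hP)
  pabs := by
    rintro Γ Δ T A R ⟨Q, h, h'⟩
    obtain ⟨B, rfl, hAB⟩ := hS.pabs h
    obtain ⟨C, rfl, hBC⟩ := hS.pabs h'
    exact ⟨C, rfl, B, hAB, hBC⟩
  nabs := by
    rintro Γ Δ k A R ⟨Q, h, h'⟩
    obtain ⟨B, rfl, hAB⟩ := hS.nabs h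
    obtain ⟨C, rfl, hBC⟩ := hS.nabs h'
    exact ⟨C, rfl, B, hAB, hBC⟩
  out := fun ⟨_, h, h'⟩ _ m A P' hP =>
    have ⟨B, Q', hQ, hAB, hPQ⟩ := hS.out h m A P' hP
    have ⟨C, R', hR, hBC, hQR⟩ := hS.out h' m B Q' hQ
    ⟨C, R', hR, ⟨B, hAB, hBC⟩, Q', hPQ, hQR⟩
  inp := fun ⟨_, h, h'⟩ _ m P' hP =>
    have ⟨Q', hQ, hPQ⟩ := hS.inp h m P' hP
    have ⟨R', hR, hQR⟩ := hS.inp h' m Q' hQ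
    ⟨R', hR, Q', hPQ, hQR⟩
  var := fun ⟨_, h, h'⟩ X P' hP =>
    have ⟨Q', hQ, hPQ⟩ := hS.var h X P' hP
    have ⟨R', hR, hQR⟩ := hS.var h' X Q' hQ
    ⟨R', hR, Q', hPQ, hQR⟩
  varAbs := by
    rintro Γ Δ T X R hT ⟨Q, h, h'⟩
    cases (hS.varAbs X hT h).headMatch with
    | proc => exact (hT rfl).elim
    | var => exact hS.varAbs X hT h'
  varPapp := fun ⟨_, h, h'⟩ _ X A P' hP =>
    have ⟨B, Q', hQ, hAB, hPQ⟩ := hS.varPapp h X A P' hP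
    have ⟨C, R', hR, hBC, hQR⟩ := hS.varPapp h' X B Q' hQ
    ⟨C, R', hR, ⟨B, hAB, hBC⟩, Q', hPQ, hQR⟩
  varNapp := fun ⟨_, h, h'⟩ _ X n P' hP =>
    have ⟨Q', hQ, hPQ⟩ := hS.varNapp h X n P' hP
    have ⟨R', hR, hQR⟩ := hS.varNapp h' X n Q' hQ
    ⟨R', hR, Q', hPQ, hQR⟩

theorem Bisim.trans {Γ Δ T} {P Q R : Tm σ Γ Δ T} (h : Bisim P Q) (h' : Bisim Q R) : Bisim P R :=
  ⟨_, isHOIOBisim_bisim.comp, Q, h, h'⟩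

theorem SCongr.bisim {Γ Δ T} {P Q : Tm σ Γ Δ T} (h : SCongr P Q) : Bisim P Q :=
  h.axEq.bisim

theorem MCongr.bisim_of_bnf {Γ Δ T} {P Q : Tm σ Γ Δ T} (h : MCongr P.bnf Q) : Bisim P Q :=
  SCongr.bisim (P.sCongr_bnf.trans h.sCongr)

theorem Factor.betaNormal {Γ Δ T} {P : Tm σ Γ Δ T} {F R : Tm σ Γ Δ .proc} (h : Factor P F R)
    (hP : P.BetaNormal) : F.BetaNormal ∧ R.BetaNormal := by
  induction h with
  | here => exact ⟨hP, trivial⟩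
  | parL Q _ ih => exact ⟨(ih hP.1).1, (ih hP.1).2, hP.2⟩
  | parR P _ ih => exact ⟨(ih hP.2).1, hP.1, (ih hP.2).2⟩

theorem Bisim.factorSim {Γ Δ} {P Q : Tm σ Γ Δ .proc} (h : Bisim P Q) (hP : P.BetaNormal)
    (hQ : Q.BetaNormal) : FactorSim Bisim P Q := by
  intro F R hF
  have hFn := (hF.betaNormal hP).1
  rw [← hQ.bnf_eq]
  cases F with
  | nil => exact hF.isPrime.elim
  | par => exact hF.isPrime.elim
  | var X =>
    obtain ⟨Q', h₁, hR⟩ := isHOIOBisim_bisim.var h X R hF.mCongr.sCongr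
    obtain ⟨F', R', h₂, hm⟩ := h₁.exists_factor hFn.bnf_eq trivial
    cases hm with
    | var _ hR' => exact ⟨_, R', h₂, .var X (hR.trans hR'.bisim_of_bnf)⟩
  | inp m A =>
    obtain ⟨Q', h₁, hA⟩ := isHOIOBisim_bisim.inp h m _ hF.inpTr
    obtain ⟨B, R', h₂, hB⟩ := h₁.exists_factor
    exact ⟨_, R', h₂, .inp m (hA.trans hB.bisim)⟩
  | out m A =>
    obtain ⟨A', Q', h₁, hA, hR⟩ := isHOIOBisim_bisim.out h m _ _ hF.outTr
    obtain ⟨B, R', h₂, hB, hR'⟩ := h₁.exists_factor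
    exact ⟨_, R', h₂, .out m (hA.trans hB.bisim) (hR.trans hR'.bisim)⟩
  | papp P A =>
    obtain ⟨X, rfl⟩ := Tm.eq_var_of_not_isAbs_pabs hFn.1
    obtain ⟨B, Q', h₁, hA, hR⟩ := isHOIOBisim_bisim.varPapp h X A R hF.mCongr.sCongr
    obtain ⟨F', R', h₂, hm⟩ := h₁.exists_factor (Tm.bnf_papp_var X B) trivial
    cases hm with
    | papp hX hB hR' =>
      exact ⟨_, R', h₂, .papp hX.sCongr.bisim (hA.trans hB.bisim_of_bnf)
        (hR.trans hR'.bisim_of_bnf)⟩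
  | napp P n =>
    obtain ⟨X, rfl⟩ := Tm.eq_var_of_not_isAbs_nabs hFn
    obtain ⟨Q', h₁, hR⟩ := isHOIOBisim_bisim.varNapp h X n R hF.mCongr.sCongr
    obtain ⟨F', R', h₂, hm⟩ := h₁.exists_factor hFn.bnf_eq trivial
    cases hm with
    | napp _ hX hR' =>
      exact ⟨_, R', h₂, .napp n hX.sCongr.bisim
        (hR.trans hR'.bisim_of_bnf)⟩

end Transitions

section PrefixSystem

/-- An abstract account of parallel compositions of inputs: a set `C` of components, some of which
have a label in `M` and a body. The body is a multiset of components in an extended context, into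
which components of the original context are carried by `wk`. Bodies only contain components that
are smaller than the component they belong to. -/
structure PrefixSystem (C M : Type u) (C' : M → Type u) where
  wk : ∀ m, C → C' m
  wk_injective : ∀ m, Function.Injective (wk m)
  Body : C → ∀ m, Multiset (C' m) → Prop
  size : C → ℕ
  label_unique : ∀ {c m m' a a'}, Body c m a → Body c m' a' → m = m'
  body_unique : ∀ {c m a a'}, Body c m a → Body c m a' → a = a'
  body_injective : ∀ {c d m a}, Body c m a → Body d m a → c = d
  wk_notMem : ∀ {c d m a}, Body c m a → size c ≤ size d → wk m d ∉ a

namespace PrefixSystem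

variable {C M : Type u} {C' : M → Type u} (𝒮 : PrefixSystem C M C')

/-- `r` is obtained from `p` by replacing a component with label `m` by its body. -/
def Step (p : Multiset C) (m : M) (r : Multiset (C' m)) : Prop :=
  ∃ c a p', p = c ::ₘ p' ∧ 𝒮.Body c m a ∧ r = a + p'.map (𝒮.wk m)

/-- Every component of `p` has a body, and every step of `p` is also a step of `q`. -/
def Sim (p q : Multiset C) : Prop :=
  (∀ c ∈ p, ∃ m a, 𝒮.Body c m a) ∧ ∀ ⦃m r⦄, 𝒮.Step p m r → 𝒮.Step q m r

/-- The only component of `p` is the left-hand side of an instance of `DIS`, and `q` consists of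
the components of its right-hand side. -/
def Expands (p q : Multiset C) : Prop :=
  ∃ F G m a b n, p = {F} ∧ q = Multiset.replicate (n + 2) G ∧ 𝒮.Body F m a ∧ 𝒮.Body G m b ∧
    a = b + Multiset.replicate (n + 1) (𝒮.wk m G)

variable {𝒮} {p q : Multiset C} {F : C}

theorem count_body_add [DecidableEq C] {m : M} [DecidableEq (C' m)] {c : C} {a : Multiset (C' m)}
    (hc : 𝒮.Body c m a) (h : 𝒮.size c ≤ 𝒮.size F) (r : Multiset C) :
    (a + r.map (𝒮.wk m)).count (𝒮.wk m F) = r.count F := by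
  rw [Multiset.count_add, Multiset.count_eq_zero_of_notMem (𝒮.wk_notMem hc h), zero_add,
    Multiset.count_map_eq_count' _ _ (𝒮.wk_injective m)]

theorem Sim.exists_match (hpq : 𝒮.Sim p q) {c : C} {p' : Multiset C} (hp : p = c ::ₘ p') :
    ∃ m a d b q', q = d ::ₘ q' ∧ 𝒮.Body c m a ∧ 𝒮.Body d m b ∧
      a + p'.map (𝒮.wk m) = b + q'.map (𝒮.wk m) := by
  obtain ⟨m, a, ha⟩ := hpq.1 c (hp ▸ Multiset.mem_cons_self c p')
  obtain ⟨d, b, q', hq, hb, hab⟩ := hpq.2 ⟨c, a, p', hp, ha, rfl⟩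
  exact ⟨m, a, d, b, q', hq, ha, hb, hab⟩

theorem eq_of_body_add_eq {m : M} {a b : Multiset (C' m)} (ha : 𝒮.Body F m a)
    (hb : 𝒮.Body F m b) (h : a + p.map (𝒮.wk m) = b + q.map (𝒮.wk m)) : p = q := by
  obtain rfl := 𝒮.body_unique ha hb
  exact Multiset.map_injective (𝒮.wk_injective m) (add_left_cancel h)

section

variable [DecidableEq C] (hp : ∀ c ∈ p, 𝒮.size c ≤ 𝒮.size F) (hq : ∀ c ∈ q, 𝒮.size c ≤ 𝒮.size F)
include hp hq

theorem Sim.exists_count_eq (hpq : 𝒮.Sim p q) {c : C} {p' : Multiset C} (hc : p = c ::ₘ p') :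
    ∃ d q', q = d ::ₘ q' ∧ p'.count F = q'.count F ∧ (c = d → p = q) := by
  classical
  obtain ⟨m, a, d, b, q', rfl, ha, hb, hab⟩ := hpq.exists_match hc
  subst hc
  refine ⟨d, q', rfl, ?_, ?_⟩
  · rw [← count_body_add ha (hp c (Multiset.mem_cons_self c p')), hab,
      count_body_add hb (hq d (Multiset.mem_cons_self d q'))]
  · rintro rfl
    rw [eq_of_body_add_eq ha hb hab]

theorem Sim.eq_of_count_eq (hpq : 𝒮.Sim p q) (hF : F ∈ p) (h : p.count F = q.count F) :
    p = q := by
  obtain ⟨p', hp'⟩ := Multiset.exists_cons_of_mem hF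
  obtain ⟨d, q', rfl, hcount, heq⟩ := hpq.exists_count_eq hp hq hp'
  refine heq (by_contra fun hd => ?_)
  rw [hp', Multiset.count_cons_self, Multiset.count_cons_of_ne hd] at h
  omega

theorem Sim.eq_of_mem_of_count_lt (hpq : 𝒮.Sim p q) (h : q.count F < p.count F) {c : C}
    (hc : c ∈ p) : c = F := by
  by_contra hcF
  obtain ⟨p', hp'⟩ := Multiset.exists_cons_of_mem hc
  obtain ⟨d, q', rfl, hcount, -⟩ := hpq.exists_count_eq hp hq hp'
  rw [hp', Multiset.count_cons_of_ne (Ne.symm hcF)] at h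
  have := Multiset.count_le_count_cons F d q'
  omega

theorem Sim.notMem_of_count_lt (hpq : 𝒮.Sim p q) (hqp : 𝒮.Sim q p)
    (h : q.count F < p.count F) : F ∉ q := by
  intro hF
  obtain ⟨q', hq'⟩ := Multiset.exists_cons_of_mem hF
  obtain ⟨d, p', hp', -, heq⟩ := hqp.exists_count_eq hq hp hq'
  have hd : d = F := hpq.eq_of_mem_of_count_lt hp hq h (hp' ▸ Multiset.mem_cons_self d p')
  exact h.ne (congrArg (Multiset.count F) (heq hd.symm))

theorem Sim.eq_singleton_of_count_lt (hpq : 𝒮.Sim p q) (hqp : 𝒮.Sim q p)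
    (h : q.count F < p.count F) : p = {F} := by
  obtain ⟨p', hp'⟩ := Multiset.exists_cons_of_mem (Multiset.count_pos.1 (Nat.zero_lt_of_lt h))
  obtain ⟨d, q', rfl, hcount, -⟩ := hpq.exists_count_eq hp hq hp'
  have hFq' : F ∉ q' := fun hF =>
    hpq.notMem_of_count_lt hp hq hqp h (Multiset.mem_cons_of_mem hF)
  have hFp' : F ∉ p' := by
    rwa [← Multiset.count_eq_zero, hcount, Multiset.count_eq_zero]
  have hp'0 : p' = 0 := Multiset.eq_zero_of_forall_notMem fun c hc =>
    hFp' (hpq.eq_of_mem_of_count_lt hp hq h (hp' ▸ Multiset.mem_cons_of_mem hc) ▸ hc)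
  rw [hp', hp'0, Multiset.cons_zero]

end

theorem Sim.exists_body_of_singleton (hq : 𝒮.Sim q {F}) {m : M} {a : Multiset (C' m)}
    (ha : 𝒮.Body F m a) {d : C} {q' : Multiset C} (hd : q = d ::ₘ q') :
    ∃ b, 𝒮.Body d m b ∧ a = b + q'.map (𝒮.wk m) := by
  obtain ⟨m', b, c, a', p', hc, hb, ha', hab⟩ := hq.exists_match hd
  obtain ⟨rfl, rfl⟩ := (Multiset.singleton_eq_cons_iff p').1 hc
  obtain rfl := 𝒮.label_unique ha ha'
  obtain rfl := 𝒮.body_unique ha ha'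
  exact ⟨b, hb, by rw [hab, Multiset.map_zero, add_zero]⟩

theorem Sim.eq_of_mem_of_singleton (hq : 𝒮.Sim q {F}) {m : M} {a : Multiset (C' m)}
    (ha : 𝒮.Body F m a) {c d : C} (hc : c ∈ q) (hd : d ∈ q) : c = d := by
  classical
  wlog hdc : 𝒮.size d ≤ 𝒮.size c generalizing c d
  · exact (this hd hc (le_of_not_ge hdc)).symm
  by_contra hcd
  obtain ⟨q₁, hq₁⟩ := Multiset.exists_cons_of_mem hc
  obtain ⟨q₂, hq₂⟩ := Multiset.exists_cons_of_mem hd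
  obtain ⟨b₁, hb₁, h₁⟩ := hq.exists_body_of_singleton ha hq₁
  obtain ⟨b₂, hb₂, h₂⟩ := hq.exists_body_of_singleton ha hq₂
  have hcount : q₁.count c = q₂.count c := by
    rw [← count_body_add hb₁ le_rfl, ← h₁, h₂, count_body_add hb₂ hdc]
  have := congrArg (Multiset.count c) (hq₁.symm.trans hq₂)
  rw [Multiset.count_cons_self, Multiset.count_cons_of_ne hcd] at this
  omega

theorem Sim.expands_of_singleton (hF : 𝒮.Sim {F} q) (hq : 𝒮.Sim q {F}) (hFq : F ∉ q) :
    𝒮.Expands {F} q := by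
  obtain ⟨m, a, G, b, q', rfl, ha, -, -⟩ := hF.exists_match (Multiset.cons_zero F).symm
  obtain ⟨b, hb, hab⟩ := hq.exists_body_of_singleton ha rfl
  obtain ⟨n, rfl⟩ : ∃ n, q' = Multiset.replicate n G :=
    ⟨_, Multiset.eq_replicate_card.2 fun d hd =>
      hq.eq_of_mem_of_singleton ha (Multiset.mem_cons_of_mem hd) (Multiset.mem_cons_self G q')⟩
  rw [Multiset.map_replicate] at hab
  cases n with
  | zero =>
    rw [Multiset.replicate_zero, add_zero] at hab
    subst hab
    exact (hFq (𝒮.body_injective ha hb ▸ Multiset.mem_cons_self _ _)).elim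
  | succ n =>
    exact ⟨F, G, m, a, b, n, rfl, (Multiset.replicate_succ G (n + 1)).symm, ha, hb, hab⟩

/-- Compare the numbers of copies of a component `F` of largest size: a step on a component `c`
keeps them all unless `c = F`, as the body of `c` is too small to contain `F`. -/
theorem Sim.eq_or_expands (hpq : 𝒮.Sim p q) (hqp : 𝒮.Sim q p) :
    p = q ∨ 𝒮.Expands p q ∨ 𝒮.Expands q p := by
  classical
  by_cases h0 : p + q = 0
  · obtain ⟨rfl, rfl⟩ := add_eq_zero.1 h0
    exact .inl rfl
  obtain ⟨F, hF, hmax⟩ := (p + q).toFinset.exists_max_image 𝒮.size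
    (Multiset.toFinset_nonempty.2 h0)
  simp only [Multiset.mem_toFinset, Multiset.mem_add] at hF hmax
  wlog hle : q.count F ≤ p.count F generalizing p q
  · have := this hqp hpq (by rwa [add_comm]) hF.symm (fun c hc => hmax c hc.symm)
      (le_of_not_ge hle)
    exact this.imp Eq.symm Or.symm
  have hp : ∀ c ∈ p, 𝒮.size c ≤ 𝒮.size F := fun c hc => hmax c (.inl hc)
  have hq : ∀ c ∈ q, 𝒮.size c ≤ 𝒮.size F := fun c hc => hmax c (.inr hc)
  rcases hle.lt_or_eq with h | h
  · have hFq := hpq.notMem_of_count_lt hp hq hqp h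
    obtain rfl := hpq.eq_singleton_of_count_lt hp hq hqp h
    exact .inr (.inl (hpq.expands_of_singleton hqp hFq))
  · rcases hF with hF | hF
    · exact .inl (hpq.eq_of_count_eq hp hq hF h.symm)
    · exact .inl (hqp.eq_of_count_eq hq hp hF h).symm

end PrefixSystem

end PrefixSystem

section Components

variable {σ : Sorting.{u}}

/-- Processes up to the commutative monoid laws. -/
def mCongrSetoid (σ : Sorting.{u}) (Γ : List (Ty σ.NSort)) (Δ : List σ.NSort) :
    Setoid (Tm σ Γ Δ .proc) where
  r P Q := MCongr P Q
  iseqv := ⟨Cong.refl, Cong.symm, Cong.trans⟩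

/-- The commutative monoid of processes up to the commutative monoid laws. -/
def ProcClass (σ : Sorting.{u}) (Γ : List (Ty σ.NSort)) (Δ : List σ.NSort) : Type u :=
  Quotient (mCongrSetoid σ Γ Δ)

/-- The class of a process. -/
def Tm.cls {Γ Δ} (P : Tm σ Γ Δ .proc) : ProcClass σ Γ Δ :=
  Quotient.mk (mCongrSetoid σ Γ Δ) P

theorem Tm.cls_eq_iff {Γ Δ} {P Q : Tm σ Γ Δ .proc} : P.cls = Q.cls ↔ MCongr P Q :=
  Quotient.eq (r := mCongrSetoid σ Γ Δ)

instance {Γ Δ} : AddCommMonoid (ProcClass σ Γ Δ) where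
  add := Quotient.map₂ Tm.par fun _ _ h _ _ h' => Cong.par h h'
  zero := Tm.nil.cls
  add_assoc := by
    rintro ⟨P⟩ ⟨Q⟩ ⟨R⟩
    exact Tm.cls_eq_iff.2 (.base (.assoc _ _ _))
  add_comm := by
    rintro ⟨P⟩ ⟨Q⟩
    exact Tm.cls_eq_iff.2 (.base (.comm _ _))
  add_zero := by
    rintro ⟨P⟩
    exact Tm.cls_eq_iff.2 (.base (.unit _))
  zero_add := by
    rintro ⟨P⟩
    exact Tm.cls_eq_iff.2 ((Cong.base (.comm _ _)).trans (.base (.unit _)))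
  nsmul := @nsmulRec _ ⟨Tm.nil.cls⟩ ⟨Quotient.map₂ Tm.par fun _ _ h _ _ h' => Cong.par h h'⟩

theorem Tm.cls_par {Γ Δ} (P Q : Tm σ Γ Δ .proc) : (Tm.par P Q).cls = P.cls + Q.cls := rfl

/-- The multiset of the prime components of a process, up to the commutative monoid laws. It is
empty for terms of other types. -/
def Tm.components {Γ : List (Ty σ.NSort)} {Δ : List σ.NSort} {T : Ty σ.NSort} :
    Tm σ Γ Δ T → Multiset (ProcClass σ Γ Δ)
  | .nil => 0
  | .var (T := .proc) x => {(Tm.var x).cls}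
  | .var _ => 0
  | .inp m P => {(Tm.inp m P).cls}
  | .out m Q => {(Tm.out m Q).cls}
  | .par P Q => P.components + Q.components
  | .pabs _ => 0
  | .papp P Q => {(Tm.papp P Q).cls}
  | .nabs _ => 0
  | .napp P n => {(Tm.napp P n).cls}

theorem Tm.IsPrime.components_eq {Γ Δ} {F : Tm σ Γ Δ .proc} (h : F.IsPrime) :
    F.components = {F.cls} := by
  cases F with
  | nil => exact h.elim
  | par => exact h.elim
  | var | inp | out | papp | napp => rfl

theorem MCongr.components_eq {Γ Δ T} {P Q : Tm σ Γ Δ T} (h : MCongr P Q) :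
    P.components = Q.components := by
  induction h with
  | base h =>
    cases h with
    | assoc => exact add_assoc _ _ _
    | comm => exact add_comm _ _
    | unit => exact add_zero _
  | refl P => rfl
  | symm _ ih => exact ih.symm
  | trans _ _ ih₁ ih₂ => exact ih₁.trans ih₂
  | inp m h => exact congrArg (fun c => ({c} : Multiset _)) (Tm.cls_eq_iff.2 (.inp m h))
  | out m h => exact congrArg (fun c => ({c} : Multiset _)) (Tm.cls_eq_iff.2 (.out m h))
  | par _ _ ih₁ ih₂ => exact congrArg₂ _ ih₁ ih₂
  | pabs => rfl
  | papp h h' => exact congrArg (fun c => ({c} : Multiset _)) (Tm.cls_eq_iff.2 (.papp h h'))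
  | nabs => rfl
  | napp n h => exact congrArg (fun c => ({c} : Multiset _)) (Tm.cls_eq_iff.2 (.napp n h))

theorem Tm.sum_components {Γ Δ} : ∀ P : Tm σ Γ Δ .proc, P.components.sum = P.cls
  | .nil => Multiset.sum_zero
  | .par P Q => by
    rw [Tm.components, Multiset.sum_add, Tm.sum_components P, Tm.sum_components Q, Tm.cls_par]
  | .var _ => Multiset.sum_singleton _
  | .inp _ _ => Multiset.sum_singleton _
  | .out _ _ => Multiset.sum_singleton _
  | .papp _ _ => Multiset.sum_singleton _
  | .napp _ _ => Multiset.sum_singleton _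

theorem Tm.mCongr_of_components_eq {Γ Δ} {P Q : Tm σ Γ Δ .proc}
    (h : P.components = Q.components) : MCongr P Q := by
  rw [← Tm.cls_eq_iff, ← Tm.sum_components, ← Tm.sum_components, h]

theorem Factor.components_eq {Γ Δ T} {P : Tm σ Γ Δ T} {F R : Tm σ Γ Δ .proc} (h : Factor P F R) :
    P.components = F.cls ::ₘ R.components := by
  induction h with
  | here h => exact h.components_eq
  | parL Q _ ih => simp only [Tm.components, ih, Multiset.cons_add]
  | parR P _ ih => simp only [Tm.components, ih, Multiset.add_cons]

theorem Tm.exists_factor_of_mem_components {Γ Δ} {c : ProcClass σ Γ Δ} :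
    ∀ {P : Tm σ Γ Δ .proc}, c ∈ P.components → ∃ F R, Factor P F R ∧ F.cls = c
  | .nil, h => (Multiset.notMem_zero _ h).elim
  | .par P Q, h => by
    rcases Multiset.mem_add.1 h with h | h
    · obtain ⟨F, R, h₁, h₂⟩ := Tm.exists_factor_of_mem_components h
      exact ⟨F, _, .parL _ h₁, h₂⟩
    · obtain ⟨F, R, h₁, h₂⟩ := Tm.exists_factor_of_mem_components h
      exact ⟨F, _, .parR _ h₁, h₂⟩
  | .var _, h => ⟨_, _, .here trivial, (Multiset.mem_singleton.1 h).symm⟩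
  | .inp _ _, h => ⟨_, _, .here trivial, (Multiset.mem_singleton.1 h).symm⟩
  | .out _ _, h => ⟨_, _, .here trivial, (Multiset.mem_singleton.1 h).symm⟩
  | .papp _ _, h => ⟨_, _, .here trivial, (Multiset.mem_singleton.1 h).symm⟩
  | .napp _ _, h => ⟨_, _, .here trivial, (Multiset.mem_singleton.1 h).symm⟩

/-- Weakening of classes of processes. -/
def ProcClass.wkP {Γ Δ} {S : Ty σ.NSort} : ProcClass σ Γ Δ → ProcClass σ (S :: Γ) Δ :=
  Quotient.map Tm.wkP fun _ _ h => Cong.wkP stable_monoidLaw h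

theorem Tm.components_wkP {Γ Δ} {S : Ty σ.NSort} :
    ∀ P : Tm σ Γ Δ .proc, (P.wkP (S := S)).components = P.components.map ProcClass.wkP
  | .nil => rfl
  | .par P Q => by
    refine (congrArg₂ _ (Tm.components_wkP P) (Tm.components_wkP Q)).trans ?_
    exact (Multiset.map_add _ _ _).symm
  | .var _ => rfl
  | .inp _ _ => rfl
  | .out _ _ => rfl
  | .papp _ _ => rfl
  | .napp _ _ => rfl

theorem Tm.components_copies {Γ Δ} (n : ℕ) {P : Tm σ Γ Δ .proc} (hP : P.IsPrime) :
    (Tm.copies n P).components = Multiset.replicate n P.cls := by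
  induction n with
  | zero => rfl
  | succ n ih =>
    simp only [Tm.copies, Tm.components, ih, hP.components_eq, Multiset.replicate_succ,
      Multiset.singleton_add]

/-- A closed term of the given type. -/
def Tm.inhabitant {Γ : List (Ty σ.NSort)} {Δ : List σ.NSort} : ∀ T : Ty σ.NSort, Tm σ Γ Δ T
  | .proc => .nil
  | .pabs _ => .pabs .nil
  | .nabs _ => .nabs .nil

theorem ProcClass.wkP_injective {Γ Δ} {S : Ty σ.NSort} :
    Function.Injective (ProcClass.wkP (σ := σ) (Γ := Γ) (Δ := Δ) (S := S)) := by
  rintro ⟨P⟩ ⟨Q⟩ h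
  have h' : MCongr (P.wkP (S := S)) Q.wkP := Tm.cls_eq_iff.1 h
  have := Cong.psubst stable_monoidLaw h' (.refl (Tm.inhabitant S))
  rw [Tm.psubst_wkP, Tm.psubst_wkP] at this
  exact Tm.cls_eq_iff.2 this

/-- The equation between inputs also identifies the sorts and the names. -/
theorem MCongr.inp_inj {Γ Δ} {k k' : σ.NSort} {m : Name σ Δ k} {m' : Name σ Δ k'}
    {A : Tm σ (σ.obj k :: Γ) Δ .proc} {B : Tm σ (σ.obj k' :: Γ) Δ .proc}
    (h : MCongr (.inp m A) (.inp m' B)) : ∃ A', MCongr A A' ∧ Tm.inp m A' = .inp m' B := by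
  obtain ⟨F, R, hF, hm⟩ := h.factorSim (.here trivial)
  cases hF
  cases hm with
  | inp _ h => exact ⟨_, (Cong.base (.unit _)).symm.trans (h.trans (.base (.unit _))), rfl⟩

/-- The number of constructors other than `0` and parallel composition. -/
def Tm.size {Γ : List (Ty σ.NSort)} {Δ : List σ.NSort} {T : Ty σ.NSort} : Tm σ Γ Δ T → ℕ
  | .nil => 0
  | .var _ => 1
  | .inp _ P => P.size + 1
  | .out _ Q => Q.size + 1
  | .par P Q => P.size + Q.size
  | .pabs P => P.size + 1
  | .papp P Q => P.size + Q.size + 1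
  | .nabs P => P.size + 1
  | .napp P _ => P.size + 1

theorem MCongr.size_eq {Γ Δ T} {P Q : Tm σ Γ Δ T} (h : MCongr P Q) : P.size = Q.size := by
  induction h with
  | base h => cases h <;> simp only [Tm.size] <;> omega
  | refl P => rfl
  | symm _ ih => exact ih.symm
  | trans _ _ ih₁ ih₂ => exact ih₁.trans ih₂
  | inp | out | par | pabs | papp | nabs | napp => simp only [Tm.size, *]

theorem Tm.size_ren {Γ Δ T} (P : Tm σ Γ Δ T) {Γ' Δ'} (ρ : PRen σ Γ Γ') (ν : NSub σ Δ Δ') :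
    (P.ren ρ ν).size = P.size := by
  induction P generalizing Γ' Δ' <;> simp only [Tm.ren, Tm.size, *]

theorem Factor.size_eq {Γ Δ T} {P : Tm σ Γ Δ T} {F R : Tm σ Γ Δ .proc} (h : Factor P F R) :
    P.size = F.size + R.size := by
  induction h with
  | here => rfl
  | parL | parR => simp only [Tm.size]; omega

/-- The size of a class of processes. -/
def ProcClass.size {Γ Δ} : ProcClass σ Γ Δ → ℕ :=
  Quotient.lift Tm.size fun _ _ h => MCongr.size_eq h

theorem ProcClass.size_wkP {Γ Δ} {S : Ty σ.NSort} (c : ProcClass σ Γ Δ) :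
    (c.wkP (S := S)).size = c.size := by
  obtain ⟨P⟩ := c
  exact Tm.size_ren P _ _

/-- Classes of processes, with the inputs as the components that have a body. -/
def inputSystem (σ : Sorting.{u}) (Γ : List (Ty σ.NSort)) (Δ : List σ.NSort) :
    PrefixSystem (ProcClass σ Γ Δ) ((k : σ.NSort) × Name σ Δ k)
      (fun m => ProcClass σ (σ.obj m.1 :: Γ) Δ) where
  wk _ := ProcClass.wkP
  wk_injective _ := ProcClass.wkP_injective
  Body c m a := ∃ A, c = (Tm.inp m.2 A).cls ∧ a = A.components
  size := ProcClass.size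
  label_unique := by
    rintro _ ⟨k, m⟩ ⟨k', m'⟩ _ _ ⟨A, rfl, rfl⟩ ⟨B, h, rfl⟩
    obtain ⟨B', -, h'⟩ := (Tm.cls_eq_iff.1 h).inp_inj
    cases h'
    rfl
  body_unique := by
    rintro _ ⟨k, m⟩ _ _ ⟨A, rfl, rfl⟩ ⟨B, h, rfl⟩
    obtain ⟨B', h₁, h'⟩ := (Tm.cls_eq_iff.1 h).inp_inj
    cases h'
    exact h₁.components_eq
  body_injective := by
    rintro _ _ ⟨k, m⟩ _ ⟨A, rfl, rfl⟩ ⟨B, rfl, h⟩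
    exact Tm.cls_eq_iff.2 (.inp m (Tm.mCongr_of_components_eq h))
  wk_notMem := by
    rintro _ d ⟨k, m⟩ _ ⟨A, rfl, rfl⟩ hsz hmem
    obtain ⟨F, R, hF, hd⟩ := Tm.exists_factor_of_mem_components hmem
    have h₁ := congrArg ProcClass.size hd
    rw [ProcClass.size_wkP] at h₁
    have h₂ := hF.size_eq
    change A.size + 1 ≤ d.size at hsz
    change F.size = d.size at h₁
    omega

end Components

section Completeness

variable {σ : Sorting.{u}}

/-- The term has no application redex, and no input in it has a body of the form
`A | ∏ m(X).A` up to the commutative monoid laws. -/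
def Tm.Normal {Γ : List (Ty σ.NSort)} {Δ : List σ.NSort} {T : Ty σ.NSort} :
    Tm σ Γ Δ T → Prop
  | .nil => True
  | .var _ => True
  | .inp m P =>
    P.Normal ∧ ∀ (n : ℕ) (A), ¬ MCongr P (.par A (Tm.copies (n + 1) (Tm.inp m A).wkP))
  | .out _ Q => Q.Normal
  | .par P Q => P.Normal ∧ Q.Normal
  | .pabs P => P.Normal
  | .papp P Q => ¬ P.IsAbs ∧ Q.Normal
  | .nabs P => P.Normal
  | .napp P _ => ¬ P.IsAbs

theorem IsNormal.of_context {Γ Δ T Γ' Δ' T'} {f : Tm σ Γ Δ T → Tm σ Γ' Δ' T'}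
    (hf : ∀ {B : TRel σ} {P Q}, Cong B P Q → Cong B (f P) (f Q))
    (hf' : ∀ {B : TRel σ} {P Q}, InSubterm B P Q → InSubterm B (f P) (f Q))
    {P : Tm σ Γ Δ T} (h : IsNormal (f P)) : IsNormal P :=
  fun Q ⟨P', Q', h₁, h₂, h₃⟩ => h (f Q) ⟨f P', f Q', hf h₁, hf' h₂, hf h₃⟩

theorem IsNormal.not_law {Γ Δ T} {P : Tm σ Γ Δ T} (h : IsNormal P) {P' Q : Tm σ Γ Δ T}
    (hP : MCongr P P') : ¬ (DisLaw P' Q ∨ AppLaw P' Q) :=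
  fun hQ => h Q ⟨P', Q, hP, .here hQ, .refl _⟩

theorem IsNormal.normal {Γ Δ T} {P : Tm σ Γ Δ T} (h : IsNormal P) : P.Normal := by
  induction P with
  | nil => trivial
  | var x => trivial
  | inp m P ih =>
    exact ⟨ih (h.of_context (.inp m) (.inp m)),
      fun n A hA => h.not_law (hA.inp m) (.inl (.dis m A (n + 2) (by omega)))⟩
  | out m Q ih => exact ih (h.of_context (.out m) (.out m))
  | par P Q ihP ihQ =>
    exact ⟨ihP (h.of_context (f := (Tm.par · Q)) (.par · (.refl _)) (.parL _)),
      ihQ (h.of_context (f := Tm.par P) (.par (.refl _)) (.parR _))⟩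
  | pabs P ih => exact ih (h.of_context .pabs .pabs)
  | papp P Q _ ihQ =>
    refine ⟨fun hP => ?_, ihQ (h.of_context (f := Tm.papp P) (.papp (.refl _)) (.pappR _))⟩
    cases P with
    | var => exact hP
    | pabs A => exact h.not_law (.refl _) (.inr (.app1 A Q))
  | nabs P ih => exact ih (h.of_context .nabs .nabs)
  | napp P n =>
    intro hP
    cases P with
    | var => exact hP
    | nabs A => exact h.not_law (.refl _) (.inr (.app2 A n))

theorem Tm.Normal.betaNormal {Γ Δ T} {P : Tm σ Γ Δ T} (h : P.Normal) : P.BetaNormal := by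
  induction P with
  | nil => trivial
  | var x => trivial
  | inp m P ih => exact ih h.1
  | out m Q ih => exact ih h
  | par P Q ihP ihQ => exact ⟨ihP h.1, ihQ h.2⟩
  | pabs P ih => exact ih h
  | papp P Q _ ihQ => exact ⟨h.1, ihQ h.2⟩
  | nabs P ih => exact ih h
  | napp P n => exact h

theorem PSub.liftP_lift_eq_var {Γ Γ' : List (Ty σ.NSort)} {Δ : List σ.NSort} {S}
    {ρ : PRen σ Γ Γ'} {θ : PSub σ Γ' Γ Δ} (h : ∀ ⦃T⦄ (x : Var Γ T), θ (ρ x) = .var x) ⦃T⦄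
    (x : Var (S :: Γ) T) : PSub.liftP θ (PRen.lift ρ x) = .var x := by
  cases x with
  | z => rfl
  | s x => simp only [PRen.lift, PSub.liftP, h]; rfl

theorem Tm.Normal.ren {Γ Δ T} {P : Tm σ Γ Δ T} (h : P.Normal) {Γ'} (ρ : PRen σ Γ Γ')
    (θ : PSub σ Γ' Γ Δ) (hθ : ∀ ⦃T⦄ (x : Var Γ T), θ (ρ x) = .var x) :
    (P.ren ρ fun _ x => .var x).Normal := by
  induction P generalizing Γ' with
  | nil => trivial
  | var x => trivial
  | inp m P ih =>
    refine ⟨ih h.1 _ _ (PSub.liftP_lift_eq_var hθ), fun n A hA => ?_⟩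
    rw [Name.sub_id] at hA
    have h' := Cong.msub stable_monoidLaw.msub hA (PSub.liftP θ) (fun _ x => .var x)
    rw [Tm.msub_ren] at h'
    simp only [PSub.liftP_lift_eq_var hθ, Tm.msub, Tm.msub_copies, Tm.msub_wkP, Name.sub_id] at h'
    change MCongr (P.msub _ fun _ x => .var x) _ at h'
    rw [Tm.msub_id] at h'
    exact h.2 n _ h'
  | out m Q ih => exact ih h _ _ hθ
  | par P Q ihP ihQ => exact ⟨ihP h.1 _ _ hθ, ihQ h.2 _ _ hθ⟩
  | pabs P ih => exact ih h _ _ (PSub.liftP_lift_eq_var hθ)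
  | papp P Q _ ihQ => exact ⟨fun hP => h.1 ((Tm.isAbs_ren _ _).1 hP), ihQ h.2 _ _ hθ⟩
  | nabs P ih =>
    simp only [Tm.ren, NSub.lift_id]
    exact ih h ρ (PSub.liftN θ) fun _ x => by simp only [PSub.liftN, hθ]; rfl
  | napp P n => exact fun hP => h ((Tm.isAbs_ren _ _).1 hP)

theorem Tm.Normal.wkP {Γ Δ T S} {P : Tm σ Γ Δ T} (h : P.Normal) : (P.wkP (S := S)).Normal :=
  h.ren _ (PSub.single (Tm.inhabitant S)) fun _ _ => rfl

theorem Factor.normal {Γ Δ T} {P : Tm σ Γ Δ T} {F R : Tm σ Γ Δ .proc} (h : Factor P F R)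
    (hP : P.Normal) : F.Normal ∧ R.Normal := by
  induction h with
  | here => exact ⟨hP, trivial⟩
  | parL Q _ ih => exact ⟨(ih hP.1).1, (ih hP.1).2, hP.2⟩
  | parR P _ ih => exact ⟨(ih hP.2).1, hP.1, (ih hP.2).2⟩

theorem Tm.exists_factor_of_cls_inp_mem {Γ Δ} {P : Tm σ Γ Δ .proc} {k} {m : Name σ Δ k}
    {A : Tm σ (σ.obj k :: Γ) Δ .proc} (h : (Tm.inp m A).cls ∈ P.components) :
    ∃ A' R, Factor P (.inp m A') R ∧ MCongr A A' := by
  obtain ⟨F, R, hF, hFA⟩ := Tm.exists_factor_of_mem_components h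
  have hcongr : MCongr (.inp m A) F := Tm.cls_eq_iff.1 hFA.symm
  obtain ⟨F', R', hF', hm⟩ := hcongr.factorSim (.here trivial)
  cases hm with
  | inp _ =>
    cases hF' with
    | here =>
      obtain ⟨A', hA', heq⟩ := hcongr.inp_inj
      cases heq
      exact ⟨_, R, hF, hA'⟩
    | parL | parR => exact hF.isPrime.elim

theorem step_components_iff {Γ Δ} {P : Tm σ Γ Δ .proc} {k} {m : Name σ Δ k}
    {r : Multiset (ProcClass σ (σ.obj k :: Γ) Δ)} :
    (inputSystem σ Γ Δ).Step P.components ⟨k, m⟩ r ↔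
      ∃ A R, Factor P (.inp m A) R ∧ r = (Tm.par A R.wkP).components := by
  constructor
  · rintro ⟨_, _, p, hp, ⟨A, rfl, rfl⟩, rfl⟩
    obtain ⟨A', R, hF, hA⟩ := Tm.exists_factor_of_cls_inp_mem (hp ▸ Multiset.mem_cons_self _ p)
    refine ⟨A', R, hF, ?_⟩
    rw [hF.components_eq, ← Tm.cls_eq_iff.2 (Cong.inp m hA), Multiset.cons_inj_right] at hp
    rw [Tm.components, Tm.components_wkP, hA.components_eq, hp]
    rfl
  · rintro ⟨A, R, hF, rfl⟩
    refine ⟨_, _, _, hF.components_eq, ⟨A, rfl, rfl⟩, ?_⟩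
    rw [Tm.components, Tm.components_wkP]
    rfl

theorem Tm.Normal.not_expands {Γ Δ} {P : Tm σ Γ Δ .proc} (hP : P.Normal)
    {q : Multiset (ProcClass σ Γ Δ)} : ¬ (inputSystem σ Γ Δ).Expands P.components q := by
  rintro ⟨_, _, ⟨k, m⟩, _, _, n, hp, -, ⟨A, rfl, rfl⟩, ⟨B, rfl, rfl⟩, hAB⟩
  obtain ⟨A', R, hF, hA⟩ := Tm.exists_factor_of_cls_inp_mem (hp ▸ Multiset.mem_singleton_self _)
  have hAB' : MCongr A (.par B (Tm.copies (n + 1) (Tm.inp m B).wkP)) := by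
    apply Tm.mCongr_of_components_eq
    rw [hAB, Tm.components, Tm.components_copies _ (by trivial)]
    rfl
  exact (hF.normal hP).1.2 n B (hA.symm.trans hAB')

/-- The term is an input `m(X).P`. -/
def Tm.IsInp {Γ Δ} {T : Ty σ.NSort} : Tm σ Γ Δ T → Prop
  | .inp _ _ => True
  | _ => False

theorem FactorMatch.isInp_iff {S : TRel σ} {Γ Δ} {F R F' R' : Tm σ Γ Δ .proc}
    (h : FactorMatch S F R F' R') : F.IsInp ↔ F'.IsInp := by
  cases h <;> exact Iff.rfl

theorem FactorMatch.mCongr_par {Γ Δ} {F R F' R' : Tm σ Γ Δ .proc}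
    (h : FactorMatch MCongr F R F' R') (hF : ¬ F.IsInp) : MCongr (.par F R) (.par F' R') := by
  cases h with
  | inp => exact (hF trivial).elim
  | out m h hR => exact .par (.out m h) hR
  | var X hR => exact .par (.refl _) hR
  | papp h h' hR => exact .par (.papp h h') hR
  | napp n h hR => exact .par (.napp n h) hR

theorem FactorSim.sim_components {Γ Δ} {P Q : Tm σ Γ Δ .proc} (h : FactorSim MCongr P Q)
    (hP : ∀ ⦃F R⦄, Factor P F R → F.IsInp) :
    (inputSystem σ Γ Δ).Sim P.components Q.components := by
  constructor
  · intro c hc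
    obtain ⟨F, R, hF, rfl⟩ := Tm.exists_factor_of_mem_components hc
    cases F with
    | inp m A => exact ⟨⟨_, m⟩, _, A, rfl, rfl⟩
    | nil | var | out | par | papp | napp => exact (hP hF).elim
  · rintro ⟨k, m⟩ r hr
    obtain ⟨A, R, hF, rfl⟩ := step_components_iff.1 hr
    obtain ⟨F', R', hF', hm⟩ := h hF
    cases hm with
    | inp _ hAB => exact step_components_iff.2 ⟨_, R', hF', hAB.components_eq⟩

theorem FactorBisim.mCongr {Γ Δ} {P Q : Tm σ Γ Δ .proc} (h : FactorBisim MCongr P Q)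
    (hP : P.Normal) (hQ : Q.Normal) : MCongr P Q := by
  by_cases hPI : ∀ ⦃F R⦄, Factor P F R → F.IsInp
  · have hQI : ∀ ⦃F R⦄, Factor Q F R → F.IsInp := by
      intro F R hF
      obtain ⟨F', R', hF', hm⟩ := h.2 hF
      exact hm.isInp_iff.2 (hPI hF')
    rcases (h.1.sim_components hPI).eq_or_expands (h.2.sim_components hQI) with heq | hexp | hexp
    · exact Tm.mCongr_of_components_eq heq
    · exact (hP.not_expands hexp).elim
    · exact (hQ.not_expands hexp).elim
  · push Not at hPI
    obtain ⟨F, R, hF, hFI⟩ := hPI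
    obtain ⟨F', R', hF', hm⟩ := h.1 hF
    exact hF.mCongr.trans ((hm.mCongr_par hFI).trans (Cong.symm hF'.mCongr))

/-- Bisimilar normal terms of total size less than `n` are equal up to the commutative monoid laws:
the induction hypothesis of the completeness proof. -/
def CompleteBelow (σ : Sorting.{u}) (n : ℕ) : Prop :=
  ∀ ⦃Γ Δ T⦄ ⦃A B : Tm σ Γ Δ T⦄, A.size + B.size < n → A.Normal → B.Normal → Bisim A B → MCongr A B

theorem Tm.Normal.of_papp {Γ Δ T} {P : Tm σ Γ Δ (.pabs T)} {A : Tm σ Γ Δ T}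
    (h : (Tm.papp P A).Normal) : P.Normal := by
  obtain ⟨X, rfl⟩ := Tm.eq_var_of_not_isAbs_pabs h.1
  trivial

theorem Tm.Normal.of_napp {Γ Δ k} {P : Tm σ Γ Δ (.nabs k)} {n : Name σ Δ k}
    (h : (Tm.napp P n).Normal) : P.Normal := by
  obtain ⟨X, rfl⟩ := Tm.eq_var_of_not_isAbs_nabs h
  trivial

theorem FactorMatch.mCongr_of_bisim {Γ Δ} {P Q F R F' R' : Tm σ Γ Δ .proc}
    (h : FactorMatch Bisim F R F' R') (hF : Factor P F R) (hF' : Factor Q F' R')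
    (hP : P.Normal) (hQ : Q.Normal) (hb : CompleteBelow σ (P.size + Q.size)) :
    FactorMatch MCongr F R F' R' := by
  have hsize := hF.size_eq
  have hsize' := hF'.size_eq
  obtain ⟨hFN, hRN⟩ := hF.normal hP
  obtain ⟨hFN', hRN'⟩ := hF'.normal hQ
  cases h with simp only [Tm.size] at hsize hsize'
  | inp m h =>
    exact .inp m (hb (by simp only [Tm.size, Tm.wkP, Tm.size_ren]; omega) ⟨hFN.1, hRN.wkP⟩
      ⟨hFN'.1, hRN'.wkP⟩ h)
  | out m h hR => exact .out m (hb (by omega) hFN hFN' h) (hb (by omega) hRN hRN' hR)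
  | var X hR => exact .var X (hb (by omega) hRN hRN' hR)
  | papp h h' hR =>
    exact .papp (hb (by omega) hFN.of_papp hFN'.of_papp h) (hb (by omega) hFN.2 hFN'.2 h')
      (hb (by omega) hRN hRN' hR)
  | napp n h hR =>
    exact .napp n (hb (by omega) hFN.of_napp hFN'.of_napp h) (hb (by omega) hRN hRN' hR)

theorem Bisim.factorSim_mCongr {Γ Δ} {P Q : Tm σ Γ Δ .proc} (h : Bisim P Q) (hP : P.Normal)
    (hQ : Q.Normal) (hb : CompleteBelow σ (P.size + Q.size)) : FactorSim MCongr P Q := by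
  intro F R hF
  obtain ⟨F', R', hF', hm⟩ := h.factorSim hP.betaNormal hQ.betaNormal hF
  exact ⟨F', R', hF', hm.mCongr_of_bisim hF hF' hP hQ hb⟩

theorem Bisim.eq_var {Γ Δ T} {X : Var Γ T} {Q : Tm σ Γ Δ T} (h : Bisim (.var X) Q)
    (hT : T ≠ .proc) : Q = .var X := by
  cases (isHOIOBisim_bisim.varAbs X hT h).headMatch with
  | proc => exact (hT rfl).elim
  | var => rfl

theorem Bisim.mCongr_of_completeBelow {Γ Δ T} {P Q : Tm σ Γ Δ T} (h : Bisim P Q)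
    (hP : P.Normal) (hQ : Q.Normal) (hb : CompleteBelow σ (P.size + Q.size)) : MCongr P Q := by
  cases T with
  | proc =>
    exact FactorBisim.mCongr ⟨h.factorSim_mCongr hP hQ hb,
      h.symm.factorSim_mCongr hQ hP (by rwa [add_comm])⟩ hP hQ
  | pabs S =>
    cases P with
    | var X => exact h.eq_var nofun ▸ .refl _
    | pabs A =>
      obtain ⟨B, rfl, hAB⟩ := isHOIOBisim_bisim.pabs h
      exact .pabs (hb (by simp only [Tm.size]; omega) hP hQ hAB)
  | nabs k =>
    cases P with
    | var X => exact h.eq_var nofun ▸ .refl _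
    | nabs A =>
      obtain ⟨B, rfl, hAB⟩ := isHOIOBisim_bisim.nabs h
      exact .nabs (hb (by simp only [Tm.size]; omega) hP hQ hAB)

theorem completeBelow (n : ℕ) : CompleteBelow σ n := by
  induction n with
  | zero => exact fun _ _ _ _ _ hn => (Nat.not_lt_zero _ hn).elim
  | succ n ih =>
    exact fun _ _ _ _ _ hn hP hQ h => h.mCongr_of_completeBelow hP hQ
      fun _ _ _ _ _ hlt => ih (hlt.trans_le (Nat.le_of_lt_succ hn))

theorem Bisim.mCongr {Γ Δ T} {P Q : Tm σ Γ Δ T} (h : Bisim P Q) (hP : P.Normal)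
    (hQ : Q.Normal) : MCongr P Q :=
  completeBelow _ (Nat.lt_succ_self _) hP hQ h

end Completeness

section NormalForms

variable {σ : Sorting.{u}}

/-- A weight in which inputs count twice the weight of their body. Rewriting by `DIS` decreases
it. -/
def Tm.weight {Γ : List (Ty σ.NSort)} {Δ : List σ.NSort} {T : Ty σ.NSort} : Tm σ Γ Δ T → ℕ
  | .nil => 0
  | .var _ => 0
  | .inp _ P => 2 * P.weight + 1
  | .out _ Q => Q.weight
  | .par P Q => P.weight + Q.weight
  | .pabs P => P.weight
  | .papp P Q => P.weight + Q.weight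
  | .nabs P => P.weight
  | .napp P _ => P.weight

theorem MCongr.weight_eq {Γ Δ T} {P Q : Tm σ Γ Δ T} (h : MCongr P Q) : P.weight = Q.weight := by
  induction h with
  | base h => cases h <;> simp only [Tm.weight] <;> omega
  | refl P => rfl
  | symm _ ih => exact ih.symm
  | trans _ _ ih₁ ih₂ => exact ih₁.trans ih₂
  | inp | out | par | pabs | papp | nabs | napp => simp only [Tm.weight, *]

theorem Tm.weight_ren {Γ Δ T} (P : Tm σ Γ Δ T) {Γ' Δ'} (ρ : PRen σ Γ Γ') (ν : NSub σ Δ Δ') :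
    (P.ren ρ ν).weight = P.weight := by
  induction P generalizing Γ' Δ' <;> simp only [Tm.ren, Tm.weight, *]

theorem Tm.weight_copies {Γ Δ} (n : ℕ) (P : Tm σ Γ Δ .proc) :
    (Tm.copies n P).weight = n * P.weight := by
  induction n with
  | zero => exact (Nat.zero_mul _).symm
  | succ n ih => rw [Tm.copies, Tm.weight, ih, Nat.succ_mul, Nat.add_comm]

theorem InSubterm.weight_lt {Γ Δ T} {P Q : Tm σ Γ Δ T} (h : InSubterm DisLaw P Q) :
    Q.weight < P.weight := by
  induction h with
  | here h =>
    cases h with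
    | dis m P k hk =>
      obtain ⟨i, rfl⟩ : ∃ i, k = i + 2 := ⟨k - 2, by omega⟩
      simp only [Tm.weight, Tm.weight_copies, Tm.wkP, Tm.weight_ren]
      rw [show i + 2 - 1 = i + 1 by omega]
      nlinarith
  | inp | out | parL | parR | pabs | pappL | pappR | nabs | napp =>
    simp only [Tm.weight]; omega

theorem Tm.betaNormal_copies {Γ Δ} (n : ℕ) {P : Tm σ Γ Δ .proc} (h : P.BetaNormal) :
    (Tm.copies n P).BetaNormal := by
  induction n with
  | zero => trivial
  | succ n ih => exact ⟨h, ih⟩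

theorem isAbs_iff_of_monoidDisLaw {Γ Δ T} {P Q : Tm σ Γ Δ T} (h : Cong MonoidDisLaw P Q) :
    P.IsAbs ↔ Q.IsAbs := by
  cases h.headMatch stable_monoidDisLaw.proc with
  | proc => exact iff_of_false (Tm.not_isAbs_proc _) (Tm.not_isAbs_proc _)
  | var | pabs | nabs => exact Iff.rfl

theorem betaNormal_iff_of_monoidDisLaw {Γ Δ T} {P Q : Tm σ Γ Δ T} (h : Cong MonoidDisLaw P Q) :
    P.BetaNormal ↔ Q.BetaNormal := by
  induction h with
  | base h =>
    rcases h with h | h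
    · cases h with
      | assoc => exact and_assoc
      | comm => exact and_comm
      | unit => exact and_iff_left trivial
    · cases h with
      | dis m P k hk =>
        obtain ⟨i, rfl⟩ : ∃ i, k = i + 1 := ⟨k - 1, by omega⟩
        exact ⟨fun h => Tm.betaNormal_copies _ (P := .inp m P) h.1,
          fun h => ⟨h.1, Tm.betaNormal_copies _ (Tm.BetaNormal.ren (P := .inp m P) h.1 _ _)⟩⟩
  | refl P => exact Iff.rfl
  | symm _ ih => exact ih.symm
  | trans _ _ ih₁ ih₂ => exact ih₁.trans ih₂
  | inp _ _ ih => exact ih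
  | out _ _ ih => exact ih
  | par _ _ ih₁ ih₂ => exact and_congr ih₁ ih₂
  | pabs _ ih => exact ih
  | papp h _ _ ih => exact and_congr (not_congr (isAbs_iff_of_monoidDisLaw h)) ih
  | nabs _ ih => exact ih
  | napp _ h _ => exact not_congr (isAbs_iff_of_monoidDisLaw h)

theorem Tm.BetaNormal.inSubterm_disLaw {Γ Δ T} {P Q : Tm σ Γ Δ T} (hP : P.BetaNormal)
    (h : InSubterm (fun _ _ _ A B => DisLaw A B ∨ AppLaw A B) P Q) : InSubterm DisLaw P Q := by
  induction h with
  | here h =>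
    rcases h with h | h
    · exact .here h
    · cases h with
      | app1 => exact (hP.1 trivial).elim
      | app2 => exact (hP trivial).elim
  | inp m _ ih => exact .inp m (ih hP)
  | out m _ ih => exact .out m (ih hP)
  | parL Q _ ih => exact .parL Q (ih hP.1)
  | parR P _ ih => exact .parR P (ih hP.2)
  | pabs _ ih => exact .pabs (ih hP)
  | pappL Q _ ih =>
    obtain ⟨x, rfl⟩ := Tm.eq_var_of_not_isAbs_pabs hP.1
    exact .pappL Q (ih trivial)
  | pappR P _ ih => exact .pappR P (ih hP.2)
  | nabs _ ih => exact .nabs (ih hP)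
  | napp n _ ih =>
    obtain ⟨x, rfl⟩ := Tm.eq_var_of_not_isAbs_nabs hP
    exact .napp n (ih trivial)

theorem Tm.BetaNormal.rewrites {Γ Δ T} {P Q : Tm σ Γ Δ T} (hP : P.BetaNormal)
    (h : Rewrites P Q) : Q.BetaNormal ∧ Q.weight < P.weight := by
  obtain ⟨P', Q', hPP', hP'Q', hQ'Q⟩ := h
  have monoidDis_of_mCongr {A B : Tm σ Γ Δ T} : MCongr A B → Cong MonoidDisLaw A B :=
    Cong.mono Or.inl
  have hP' := (betaNormal_iff_of_monoidDisLaw (monoidDis_of_mCongr hPP')).1 hP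
  have hdis := hP'.inSubterm_disLaw hP'Q'
  have hcong : Cong MonoidDisLaw P' Q' :=
    (Cong.compatible _).of_inSubterm (fun h => .base (.inr h)) hdis
  refine ⟨(betaNormal_iff_of_monoidDisLaw (hcong.trans (monoidDis_of_mCongr hQ'Q))).1 hP', ?_⟩
  rw [hPP'.weight_eq, ← hQ'Q.weight_eq]
  exact hdis.weight_lt

theorem Tm.BetaNormal.exists_normalFormOf {Γ Δ T} {P : Tm σ Γ Δ T} (hP : P.BetaNormal) :
    ∃ N, NormalFormOf N P := by
  induction hn : P.weight using Nat.strong_induction_on generalizing P with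
  | _ n ih =>
  by_cases h : IsNormal P
  · exact ⟨P, .refl, h⟩
  · simp only [IsNormal, not_forall, not_not] at h
    obtain ⟨Q, hQ⟩ := h
    obtain ⟨hQ', hlt⟩ := hP.rewrites hQ
    obtain ⟨N, h₁, h₂⟩ := ih _ (hn ▸ hlt) hQ' rfl
    exact ⟨N, h₁.head hQ, h₂⟩

theorem Tm.exists_normalFormOf {Γ Δ T} (P : Tm σ Γ Δ T) : ∃ N, NormalFormOf N P := by
  obtain ⟨N, h₁, h₂⟩ := P.betaNormal_bnf.exists_normalFormOf
  refine ⟨N, .trans (P.appSteps_bnf.lift id fun A B h => ?_) h₁, h₂⟩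
  exact ⟨A, B, .refl _, h.mono Or.inr, .refl _⟩

theorem Rewrites.axEq {Γ Δ T} {P Q : Tm σ Γ Δ T} (h : Rewrites P Q) : AxEq P Q := by
  obtain ⟨P', Q', hPP', hP'Q', hQ'Q⟩ := h
  have hcong : AxEq P' Q' := (Cong.compatible _).of_inSubterm (fun h => .base (.inr h)) hP'Q'
  exact hPP'.sCongr.axEq.trans (hcong.trans hQ'Q.sCongr.axEq)

theorem NormalFormOf.axEq {Γ Δ T} {N P : Tm σ Γ Δ T} (h : NormalFormOf N P) : AxEq P N := by
  have hs := h.1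
  clear h
  induction hs with
  | refl => exact .refl _
  | tail _ h ih => exact ih.trans h.axEq

theorem NormalFormOf.bisim_iff {Γ Δ T} {P Q N M : Tm σ Γ Δ T} (hN : NormalFormOf N P)
    (hM : NormalFormOf M Q) : Bisim P Q ↔ SCongr N M :=
  ⟨fun h => (((hN.axEq.bisim.symm.trans h).trans hM.axEq.bisim).mCongr hN.2.normal
      hM.2.normal).sCongr,
    fun h => (hN.axEq.bisim.trans h.bisim).trans hM.axEq.bisim.symm⟩

theorem bisim_iff_axEq {Γ Δ T} {P Q : Tm σ Γ Δ T} : Bisim P Q ↔ AxEq P Q := by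
  refine ⟨fun h => ?_, AxEq.bisim⟩
  obtain ⟨N, hN⟩ := P.exists_normalFormOf
  obtain ⟨M, hM⟩ := Q.exists_normalFormOf
  exact hN.axEq.trans (((hN.bisim_iff hM).1 h).axEq.trans (Cong.symm hM.axEq))

end NormalForms

end HOmp

theorem mainTheorem9 (σ : HOmp.Sorting)
    (Γ : List (HOmp.Ty σ.NSort)) (Δ : List σ.NSort) (T : HOmp.Ty σ.NSort) :
    -- every term has a normal form, unique up to structural congruence
    (∀ P : HOmp.Tm σ Γ Δ T,
      (∃ N, HOmp.NormalFormOf N P) ∧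
      ∀ N N', HOmp.NormalFormOf N P → HOmp.NormalFormOf N' P → HOmp.SCongr N N') ∧
    -- soundness of rewriting and of normalization
    (∀ P Q : HOmp.Tm σ Γ Δ T, HOmp.Rewrites P Q → HOmp.Bisim P Q) ∧
    (∀ P N : HOmp.Tm σ Γ Δ T, HOmp.NormalFormOf N P → HOmp.Bisim P N) ∧
    -- completeness: bisimilar terms have structurally congruent normal forms, and conversely
    (∀ P Q N M : HOmp.Tm σ Γ Δ T, HOmp.NormalFormOf N P → HOmp.NormalFormOf M Q →
      (HOmp.Bisim P Q ↔ HOmp.SCongr N M)) ∧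
    -- the axiom system is sound and complete
    (∀ P Q : HOmp.Tm σ Γ Δ T, HOmp.Bisim P Q ↔ HOmp.AxEq P Q) :=
  ⟨fun P => ⟨P.exists_normalFormOf, fun _ _ hN hN' =>
      (hN.bisim_iff hN').1 (HOmp.AxEq.bisim (.refl P))⟩,
    fun _ _ h => h.axEq.bisim, fun _ _ h => h.axEq.bisim,
    fun _ _ _ _ hN hM => hN.bisim_iff hM, fun _ _ => HOmp.bisim_iff_axEq⟩
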